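/- **Conventions.** "Definable" means definable with parameters. Let $\mathcal R=(R,<,+,0,\dots)$ be an expansion of a nontrivial, densely linearly ordered abelian group; $R$ carries the order topology and $R^n$ the product topology. An open interval is a set $(a,b)=\{x\in R: a<x<b\}$ with $a,b\in R$. A structure expanding a dense linear order without endpoints with universe $R$ is *definably complete* if every definable subset of $R$ has a supremum and an infimum in $R\cup\{\pm\infty\}$, and *locally o-minimal* if for every definable $X\subseteq R$ and every $a\in R$ there is an open interval $I\ni a$ such that $X\cap I$ is a finite union of points and open intervals. The *open core* of $\mathcal R$ is the structure with universe $R$ whose basic relations are the open subsets of $R^n$, $n\ge 0$, that are definable in $\mathcal R$. A subset of $R^n$ is *constructible* if it is a finite Boolean combination of open subsets of $R^n$. **Theorem 1.1.** Let $\mathcal R=(R,<,+,0,\dots)$ be a definably complete expansion of a nontrivial densely linearly ordered abelian group. The following are equivalent: 1. Every closed subset of $R$ definable in $\mathcal R$ is discrete or contains a nonempty open interval. 2. The open core of $\mathcal R$ is locally o-minimal. Furthermore, if one (hence both) of these conditions holds, then for every $n$, every subset of $R^n$ definable in the open core of $\mathcal R$ is constructible. -/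

import Mathlib

open Set FirstOrder

/-- The function symbols of the language of ordered groups: a constant `0` and a binary `+`. -/
inductive OrderedGroupFunctions : ℕ → Type
  | zero : OrderedGroupFunctions 0
  | add : OrderedGroupFunctions 2

/-- The relation symbols of the language of ordered groups: a binary `<`. -/
inductive OrderedGroupRelations : ℕ → Type
  | lt : OrderedGroupRelations 2

/-- The first-order language `(<, +, 0)` of ordered groups. -/
def orderedGroupLanguage : Language where
  Functions := OrderedGroupFunctions
  Relations := OrderedGroupRelations

/-- The standard interpretation of `(<, +, 0)` in an ordered additive group. -/
instance orderedGroupStructure (R : Type*) [AddCommGroup R] [LinearOrder R] :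
    orderedGroupLanguage.Structure R where
  funMap := fun f v =>
    match f, v with
    | OrderedGroupFunctions.zero, _ => 0
    | OrderedGroupFunctions.add, v => v 0 + v 1
  RelMap := fun r v =>
    match r, v with
    | OrderedGroupRelations.lt, v => v 0 < v 1

/-- A linearly ordered `L`-structure `R` is definably complete if every subset `X` of `R` that is
definable with parameters has a supremum and an infimum in `R ∪ {±∞}`. The supremum of the empty
set is `-∞` and that of a set not bounded above is `+∞`, so what is required is a supremum in `R`
when `X` is nonempty and bounded above; dually for infima. -/
def DefinablyComplete (L : Language) (R : Type*) [L.Structure R] [LinearOrder R] : Prop :=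
  ∀ X : Set R, (univ : Set R).Definable₁ L X → X.Nonempty →
    (BddAbove X → ∃ s, IsLUB X s) ∧ (BddBelow X → ∃ i, IsGLB X i)

/-- `Y` is a finite union of points and open intervals `(a, b)` with endpoints `a, b` in `R`. -/
def IsFiniteUnionOfPointsAndIntervals {R : Type*} [LinearOrder R] (Y : Set R) : Prop :=
  ∃ (P : Set R) (J : Set (R × R)), P.Finite ∧ J.Finite ∧ Y = P ∪ ⋃ p ∈ J, Ioo p.1 p.2

/-- A linearly ordered `L`-structure `R` is locally o-minimal if for every subset `X` of `R`
definable with parameters and every `a` in `R` there is an open interval `I` containing `a` such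
that `X ∩ I` is a finite union of points and open intervals. -/
def LocallyOMinimal (L : Language) (R : Type*) [L.Structure R] [LinearOrder R] : Prop :=
  ∀ X : Set R, (univ : Set R).Definable₁ L X → ∀ a : R,
    ∃ c d : R, a ∈ Ioo c d ∧ IsFiniteUnionOfPointsAndIntervals (X ∩ Ioo c d)

/-- The language of the open core of the `L`-structure `R`: one `n`-ary relation symbol for each
open subset of `R ^ n` that is definable in `R` with parameters, for every `n`, and nothing else. -/
def openCoreLanguage (L : Language) (R : Type*) [L.Structure R] [TopologicalSpace R] :
    Language where
  Functions := fun _ => Empty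
  Relations := fun n => {U : Set (Fin n → R) // (univ : Set R).Definable L U ∧ IsOpen U}

/-- The open core of `R`: the universe is `R`, and each relation symbol is interpreted as the
definable open set that it names. -/
instance openCoreStructure (L : Language) (R : Type*) [L.Structure R] [TopologicalSpace R] :
    (openCoreLanguage L R).Structure R where
  funMap := fun f _ => Empty.elim f
  RelMap := fun U v => v ∈ U.1

/-- A subset of a topological space is constructible if it is a finite Boolean combination of
open sets, that is, if it lies in the Boolean algebra of sets generated by the open sets. -/
def IsFiniteBooleanCombinationOfOpens {T : Type*} [TopologicalSpace T] (S : Set T) : Prop :=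
  S ∈ BooleanSubalgebra.closure {U : Set T | IsOpen U}

/-- Every closed subset of `R` definable with parameters in the `L`-structure `R` is discrete or
contains a nonempty open interval. -/
def DefinableClosedSetsDiscreteOrContainInterval (L : Language) (R : Type*) [L.Structure R]
    [LinearOrder R] [TopologicalSpace R] : Prop :=
  ∀ X : Set R, (univ : Set R).Definable₁ L X → IsClosed X →
    DiscreteTopology X ∨ ∃ a b : R, (Ioo a b).Nonempty ∧ Ioo a b ⊆ X

/-! The implication from local o-minimality is soft. A definable closed set is definable in the open
core, so near each point it is a finite union of points and intervals; if it contains no interval it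
is locally finite, hence discrete.

For the converse, call a set Σ if it is the union of a definable family of closed bounded sets that
increases in `r` and as `s` decreases to 0. Definable open and closed sets are Σ, and Σ sets are
stable under unions, intersections and coordinate projections, the last by definable compactness
(`isClosed_exists`). The crux is stability under complement (`IsSigma.compl`): induction on formulas
then shows that every set definable in the open core is Σ.

Complements are handled by proving that Σ sets are finite Boolean combinations of definable open
sets, which also gives the final assertion. With `G` the closure of `closure A \ A`, one has `A =
(closure A \ G) ∪ (A ∩ G)`, and `G` has smaller dimension than `A`
(`IsSigma.interior_image_closure_diff`), dimension being measured by coordinate projections with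
interior. So induction on dimension applies to `A ∩ G`.

The dimension drop rests on a Baire property: a Σ set dense in an open set contains a nonempty open
set. On the line it comes from `exists_separated_of_chain`: an increasing definable chain of closed
bounded sets without interior has a uniform lower bound on gaps, since otherwise the least gaps
would accumulate at 0 and, by hypothesis, be dense in an interval, whereas the differences of a
single member form a closed set without interior. It passes to products by a Kuratowski–Ulam
argument (`definablyBaire_prod`).

Local o-minimality follows: by the Baire property the frontier of an open-core definable subset of
the line has no interior, so it is discrete, and on a short interval on either side of a point
membership is constant. -/

open Topology

universe u v

set_option linter.unusedSectionVars false

/-! ### Coordinate spaces: finite powers of `R` and their products -/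

/-- A topological space identified with a finite power of `R`. -/
class CoordSpace (R : Type u) [TopologicalSpace R] (X : Type v) [TopologicalSpace X] where
  index : Type
  finite_index : Finite index
  coord : X ≃ₜ (index → R)

namespace CoordSpace

attribute [instance] finite_index

section Instances

variable {R : Type u} [TopologicalSpace R] {X Y : Type*} [TopologicalSpace X] [TopologicalSpace Y]

instance self : CoordSpace R R := ⟨Unit, inferInstance, (Homeomorph.funUnique Unit R).symm⟩

instance pi {ι : Type} [Finite ι] : CoordSpace R (ι → R) := ⟨ι, inferInstance, Homeomorph.refl _⟩

instance punit : CoordSpace R PUnit.{v + 1} :=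
  ⟨Empty, inferInstance,
    { toFun := fun _ i => i.elim
      invFun := fun _ => PUnit.unit
      left_inv := fun _ => rfl
      right_inv := fun _ => Subsingleton.elim _ _ }⟩

instance prod [CoordSpace R X] [CoordSpace R Y] : CoordSpace R (X × Y) :=
  ⟨index R X ⊕ index R Y, inferInstance,
    (coord.prodCongr coord).trans Homeomorph.sumArrowHomeomorphProdArrow.symm⟩

variable [CoordSpace R X] [CoordSpace R Y]

@[simp] lemma coord_prod_inl (p : X × Y) (i : index R X) :
    (coord (R := R) p : index R X ⊕ index R Y → R) (Sum.inl i) = coord p.1 i := rfl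

@[simp] lemma coord_prod_inr (p : X × Y) (i : index R Y) :
    (coord (R := R) p : index R X ⊕ index R Y → R) (Sum.inr i) = coord p.2 i := rfl

lemma ext_coord {x y : X} (h : ∀ i : index R X, coord x i = coord y i) : x = y :=
  (coord (R := R)).injective (funext h)

end Instances

end CoordSpace

open CoordSpace

/-! ### Calculus of definable sets, predicates and maps -/

section Definability

variable (L : Language) (R : Type u) [TopologicalSpace R] [L.Structure R]
variable {X Y Z : Type*} [TopologicalSpace X] [TopologicalSpace Y] [TopologicalSpace Z]
variable [CoordSpace R X] [CoordSpace R Y] [CoordSpace R Z]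

/-- A subset of a coordinate space is definable with parameters. -/
def DefSet (S : Set X) : Prop :=
  (univ : Set R).Definable L {v : index R X → R | coord.symm v ∈ S}

/-- A predicate on a coordinate space is definable with parameters. -/
@[fun_prop] def DefPred (P : X → Prop) : Prop := DefSet L R {x | P x}

/-- A map between coordinate spaces is definable with parameters. -/
@[fun_prop] def DefMap (f : X → Y) : Prop := DefSet L R {p : X × Y | p.2 = f p.1}

variable {L R}

lemma DefPred.defSet {P : X → Prop} (h : DefPred L R P) : DefSet L R {x | P x} := h

lemma DefPred.congr_pred {P Q : X → Prop} (h : DefPred L R P) (hPQ : ∀ x, P x ↔ Q x) :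
    DefPred L R Q := by
  rwa [show Q = P from funext fun x => propext (hPQ x).symm]

lemma DefMap.graph {f : X → Y} (h : DefMap L R f) : DefPred L R fun p : X × Y => p.2 = f p.1 := h

/-- Products are indexed by sums of index types, so rearranging or forgetting factors is a
reindexing `σ` of coordinates. The variable shuffles needed for composition and pairing reduce to
this. -/
lemma DefSet.preimage_coord {S : Set Y} (hS : DefSet L R S) (m : X → Y)
    (σ : index R Y → index R X) (h : ∀ x i, coord (m x) i = coord (R := R) x (σ i)) :
    DefSet L R (m ⁻¹' S) := by
  have h1 := Set.Definable.preimage_comp σ hS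
  unfold DefSet
  convert h1 using 1
  ext v
  simp only [mem_preimage, mem_ofPred_eq]
  have : m (coord.symm v) = coord.symm (v ∘ σ) := by
    apply ext_coord (R := R)
    intro i
    simp [h]
  rw [this]

@[fun_prop] lemma DefPred.not {P : X → Prop} (hP : DefPred L R P) : DefPred L R fun x => ¬ P x :=
  Set.Definable.compl hP

@[fun_prop] lemma DefPred.and {P Q : X → Prop} (hP : DefPred L R P) (hQ : DefPred L R Q) :
    DefPred L R fun x => P x ∧ Q x :=
  Set.Definable.inter hP hQ

@[fun_prop] lemma DefPred.or {P Q : X → Prop} (hP : DefPred L R P) (hQ : DefPred L R Q) :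
    DefPred L R fun x => P x ∨ Q x :=
  Set.Definable.union hP hQ

@[fun_prop] lemma DefPred.imp {P Q : X → Prop} (hP : DefPred L R P) (hQ : DefPred L R Q) :
    DefPred L R fun x => P x → Q x := by
  simp only [imp_iff_not_or]
  exact hP.not.or hQ

@[fun_prop] lemma DefPred.exists {P : X → Y → Prop} (hP : DefPred L R fun p : X × Y => P p.1 p.2) :
    DefPred L R fun x => ∃ y, P x y := by
  have h1 := Set.Definable.image_comp hP (Sum.inl : index R X → index R X ⊕ index R Y)
  unfold DefPred DefSet
  convert h1 using 1
  ext v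
  simp only [mem_ofPred_eq, mem_image]
  constructor
  · rintro ⟨y, hy⟩
    refine ⟨coord (R := R) (coord.symm v, y), ?_, ?_⟩
    · simpa using hy
    · funext i
      change coord (R := R) (coord.symm v) i = v i
      simp
  · rintro ⟨w, hw, rfl⟩
    obtain ⟨p, rfl⟩ := (coord (R := R) (X := X × Y)).surjective w
    refine ⟨p.2, ?_⟩
    have : (coord (R := R)).symm (coord (R := R) p ∘ Sum.inl) = p.1 := by
      apply ext_coord (R := R)
      intro i
      simp
    rw [this]
    simpa using hw

@[fun_prop] lemma DefPred.forall {P : X → Y → Prop} (hP : DefPred L R fun p : X × Y => P p.1 p.2) :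
    DefPred L R fun x => ∀ y, P x y := by
  have := (DefPred.exists (P := fun x y => ¬ P x y) hP.not).not
  simpa using this

@[fun_prop] lemma DefPred.forall_finite {ι : Type*} [Finite ι] {P : X → ι → Prop}
    (hP : ∀ i, DefPred L R fun x => P x i) : DefPred L R fun x => ∀ i, P x i := by
  have := Set.definable_iInter_of_finite (A := (univ : Set R)) (L := L) hP
  unfold DefPred DefSet
  convert this using 1
  ext v
  simp

@[fun_prop] lemma DefPred.const (p : Prop) : DefPred L R fun _ : X => p := by
  by_cases h : p
  · simp [DefPred, DefSet, h]
  · simp [DefPred, DefSet, h]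

lemma DefPred.coord_eq (i j : index R X) :
    DefPred L R fun x : X => coord (R := R) x i = coord x j := by
  have h := Set.Definable.preimage_comp ![i, j] (Set.Definable.diagonal (L := L) (univ : Set R))
  unfold DefPred DefSet
  convert h using 1
  ext v
  simp [diagonal]

lemma DefPred.coord_eq_const (i : index R X) (c : R) :
    DefPred L R fun x : X => coord (R := R) x i = c := by
  have h := Set.Definable.preimage_comp (fun _ : Fin 1 => i)
    ((Set.Definable.singleton (L := L) c).mono (subset_univ _) : (univ : Set R).Definable L _)
  unfold DefPred DefSet
  convert h using 1
  ext v
  simp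

lemma DefMap.of_coord (m : X → Y) (σ : index R Y → index R X)
    (h : ∀ x i, coord (m x) i = coord (R := R) x (σ i)) : DefMap L R m := by
  have := DefPred.forall_finite (L := L) (R := R) (X := X × Y)
    fun i => DefPred.coord_eq (Sum.inr i) (Sum.inl (σ i))
  refine this.congr_pred fun p => ?_
  simp only [coord_prod_inl, coord_prod_inr, ← h]
  exact ⟨fun h => ext_coord h, fun h i => by rw [h]⟩

@[fun_prop] lemma DefMap.id : DefMap L R fun x : X => x := DefMap.of_coord _ (fun i => i) fun _ _ => rfl

@[fun_prop] lemma DefMap.const (c : Y) : DefMap L R fun _ : X => c := by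
  have := DefPred.forall_finite (L := L) (R := R) (X := X × Y)
    fun i => DefPred.coord_eq_const (Sum.inr i) (coord c i)
  refine this.congr_pred fun p => ?_
  exact ⟨fun h => ext_coord h, fun h i => by rw [← show p.2 = c from h]; rfl⟩

@[fun_prop] lemma DefMap.mem {f : X → Y} (hf : DefMap L R f) {S : Set Y} (hS : DefSet L R S) :
    DefPred L R fun x => f x ∈ S := by
  have h2 : DefPred L R fun p : X × Y => p.2 ∈ S :=
    DefSet.preimage_coord hS Prod.snd Sum.inr fun _ _ => rfl
  have := DefPred.exists (P := fun x y => y = f x ∧ y ∈ S) (hf.graph.and h2)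
  simpa using this

@[fun_prop] lemma DefMap.comp {g : Y → Z} (hg : DefMap L R g) {f : X → Y} (hf : DefMap L R f) :
    DefMap L R fun x => g (f x) := by
  have h1 : DefPred L R fun p : (X × Z) × Y => p.2 = f p.1.1 :=
    DefSet.preimage_coord hf (fun p : (X × Z) × Y => (p.1.1, p.2))
      (Sum.elim (fun i => Sum.inl (Sum.inl i)) Sum.inr) (by rintro x (i | i) <;> rfl)
  have h2 : DefPred L R fun p : (X × Z) × Y => p.1.2 = g p.2 :=
    DefSet.preimage_coord hg (fun p : (X × Z) × Y => (p.2, p.1.2))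
      (Sum.elim Sum.inr (fun i => Sum.inl (Sum.inr i))) (by rintro x (i | i) <;> rfl)
  have := DefPred.exists (P := fun (p : X × Z) y => y = f p.1 ∧ p.2 = g y) (h1.and h2)
  simpa [DefMap, DefPred] using this

@[fun_prop] lemma DefMap.prodMk {f : X → Y} (hf : DefMap L R f) {g : X → Z} (hg : DefMap L R g) :
    DefMap L R fun x => (f x, g x) := by
  have h1 : DefPred L R fun p : X × Y × Z => p.2.1 = f p.1 :=
    DefSet.preimage_coord hf (fun p : X × Y × Z => (p.1, p.2.1))
      (Sum.elim Sum.inl fun i => Sum.inr (Sum.inl i)) (by rintro x (i | i) <;> rfl)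
  have h2 : DefPred L R fun p : X × Y × Z => p.2.2 = g p.1 :=
    DefSet.preimage_coord hg (fun p : X × Y × Z => (p.1, p.2.2))
      (Sum.elim Sum.inl fun i => Sum.inr (Sum.inr i)) (by rintro x (i | i) <;> rfl)
  have := h1.and h2
  simpa [DefMap, DefPred, Prod.ext_iff] using this

lemma DefMap.fst_proj : DefMap L R fun p : X × Y => p.1 := DefMap.of_coord _ Sum.inl fun _ _ => rfl

lemma DefMap.snd_proj : DefMap L R fun p : X × Y => p.2 := DefMap.of_coord _ Sum.inr fun _ _ => rfl

@[fun_prop] lemma DefMap.fst {f : X → Y × Z} (hf : DefMap L R f) : DefMap L R fun x => (f x).1 :=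
  DefMap.fst_proj.comp hf

@[fun_prop] lemma DefMap.snd {f : X → Y × Z} (hf : DefMap L R f) : DefMap L R fun x => (f x).2 :=
  DefMap.snd_proj.comp hf

@[fun_prop] lemma DefMap.coord_apply (i : index R X) : DefMap L R fun x : X => (coord x i : R) :=
  DefMap.of_coord _ (fun _ => i) fun _ _ => rfl

@[fun_prop] lemma DefMap.apply {ι : Type} [Finite ι] (i : ι) : DefMap L R fun x : ι → R => x i :=
  DefMap.of_coord _ (fun _ => i) fun _ _ => rfl

@[fun_prop] lemma DefMap.eq {f g : X → Y} (hf : DefMap L R f) (hg : DefMap L R g) :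
    DefPred L R fun x => f x = g x := by
  have h : DefPred L R fun p : Y × Y => p.2 = p.1 := DefMap.id
  exact (hg.prodMk hf).mem h

@[fun_prop] lemma DefMap.pi {ι : Type} [Finite ι] {f : X → ι → R} (hf : ∀ i, DefMap L R fun x => f x i) :
    DefMap L R f := by
  have := DefPred.forall_finite (L := L) (R := R) (X := X × (ι → R))
    (P := fun p i => p.2 i = f p.1 i)
    fun i => DefMap.eq ((DefMap.apply i).comp DefMap.snd_proj) ((hf i).comp DefMap.fst_proj)
  simpa [DefMap, DefPred, funext_iff] using this

end Definability

/-! ### Definability of the order and the group operations -/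

section Group

/-- An expansion of an ordered abelian group that is definably complete. -/
class DefinablyCompleteGroup (L : Language) (R : Type u) [L.Structure R] [AddCommGroup R]
    [LinearOrder R] : Prop where
  definable_lt : (univ : Set R).Definable L {v : Fin 2 → R | v 0 < v 1}
  definable_add : (univ : Set R).Definable L {v : Fin 3 → R | v 0 + v 1 = v 2}
  complete : DefinablyComplete L R

variable {L : Language} {R : Type u} [TopologicalSpace R] [L.Structure R] [AddCommGroup R]
  [LinearOrder R] [IsOrderedAddMonoid R] [DefinablyCompleteGroup L R]
variable {X Y Z : Type*} [TopologicalSpace X] [TopologicalSpace Y] [TopologicalSpace Z]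
variable [CoordSpace R X] [CoordSpace R Y] [CoordSpace R Z]

@[fun_prop] lemma DefMap.lt {f g : X → R} (hf : DefMap L R f) (hg : DefMap L R g) :
    DefPred L R fun x => f x < g x := by
  have h : DefSet L R {v : Fin 2 → R | v 0 < v 1} :=
    DefinablyCompleteGroup.definable_lt (L := L) (R := R)
  have h2 : DefMap L R fun x => ![f x, g x] :=
    DefMap.pi fun i => by fin_cases i <;> simpa
  exact h2.mem h

@[fun_prop] lemma DefMap.le {f g : X → R} (hf : DefMap L R f) (hg : DefMap L R g) :
    DefPred L R fun x => f x ≤ g x := by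
  simpa using (hg.lt hf).not

@[fun_prop] lemma DefMap.add {f g : X → R} (hf : DefMap L R f) (hg : DefMap L R g) :
    DefMap L R fun x => f x + g x := by
  have h : DefSet L R {v : Fin 3 → R | v 0 + v 1 = v 2} :=
    DefinablyCompleteGroup.definable_add (L := L) (R := R)
  have h2 : DefMap L R fun p : X × R => ![f p.1, g p.1, p.2] :=
    DefMap.pi fun i => by fin_cases i <;> simp <;> fun_prop
  refine (h2.mem h).congr_pred fun p => ?_
  simp [eq_comm]

@[fun_prop] lemma DefMap.sub {f g : X → R} (hf : DefMap L R f) (hg : DefMap L R g) :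
    DefMap L R fun x => f x - g x := by
  have : DefPred L R fun p : X × R => p.2 + g p.1 = f p.1 := by fun_prop
  exact this.congr_pred fun p => by simp [eq_sub_iff_add_eq]

@[fun_prop] lemma DefMap.neg {f : X → R} (hf : DefMap L R f) : DefMap L R fun x => - f x := by
  have : DefMap L R fun x => 0 - f x := by fun_prop
  simpa using this

@[fun_prop] lemma DefMap.abs {f : X → R} (hf : DefMap L R f) : DefMap L R fun x => |f x| := by
  have : DefPred L R fun p : X × R =>
      (f p.1 ≤ p.2 ∧ - f p.1 ≤ p.2) ∧ (p.2 = f p.1 ∨ p.2 = - f p.1) := by fun_prop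
  refine this.congr_pred fun p => ?_
  simp only []
  constructor
  · rintro ⟨⟨h1, h2⟩, h | h⟩
    · rw [h] at h2 ⊢; exact (abs_of_nonneg (neg_le_self_iff.1 h2)).symm
    · rw [h] at h1 ⊢; exact (abs_of_nonpos (le_neg_self_iff.1 h1)).symm
  · intro h
    change p.2 = |f p.1| at h
    rw [h]
    exact ⟨⟨le_abs_self _, neg_le_abs _⟩, abs_choice _⟩

end Group

/-! ### Boxes as a neighbourhood basis, and boundedness -/

section Boxes

variable {R : Type u} [TopologicalSpace R] [AddCommGroup R] [LinearOrder R] [IsOrderedAddMonoid R]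
  [DenselyOrdered R] [Nontrivial R] [OrderTopology R]
variable {X Y Z : Type*} [TopologicalSpace X] [TopologicalSpace Y] [TopologicalSpace Z]
variable [CoordSpace R X] [CoordSpace R Y] [CoordSpace R Z]

/-- The open box of radius `ε` around `x` contains `y`. -/
def Near (ε : R) (x y : X) : Prop := ∀ i : index R X, |coord y i - coord x i| < ε

/-- The closed box of radius `ε` around `x` contains `y`. -/
def ClosedNear (ε : R) (x y : X) : Prop := ∀ i : index R X, |coord y i - coord x i| ≤ ε

/-- All coordinates of `x` are bounded by `M`. -/
def BddBy (M : R) (x : X) : Prop := ∀ i : index R X, |coord x i| ≤ M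

/-- A subset of a coordinate space all of whose coordinates are bounded. -/
def IsBdd (R : Type u) [TopologicalSpace R] [AddCommGroup R] [LinearOrder R]
    {X : Type*} [TopologicalSpace X] [CoordSpace R X] (S : Set X) : Prop :=
  ∃ M : R, ∀ x ∈ S, BddBy M x

lemma near_refl {ε : R} (hε : 0 < ε) (x : X) : Near ε x x := fun i => by simpa

lemma Near.closedNear {ε : R} {x y : X} (h : Near ε x y) : ClosedNear ε x y := fun i => (h i).le

lemma Near.mono {ε δ : R} {x y : X} (h : Near ε x y) (hεδ : ε ≤ δ) : Near δ x y :=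
  fun i => (h i).trans_le hεδ

lemma ClosedNear.near {ε δ : R} {x y : X} (h : ClosedNear ε x y) (hεδ : ε < δ) : Near δ x y :=
  fun i => (h i).trans_lt hεδ

lemma BddBy.mono {M N : R} {x : X} (h : BddBy M x) (hMN : M ≤ N) : BddBy N x :=
  fun i => (h i).trans hMN

@[simp] lemma near_self {ε x y : R} : Near ε x y ↔ |y - x| < ε := by
  refine ⟨fun h => h (), fun h i => h⟩

@[simp] lemma bddBy_self {M x : R} : BddBy M x ↔ |x| ≤ M := by
  refine ⟨fun h => h (), fun h i => h⟩

@[simp] lemma bddBy_pi {ι : Type} [Finite ι] {M : R} {x : ι → R} :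
    BddBy M x ↔ ∀ i, |x i| ≤ M := Iff.rfl

@[simp] lemma near_prod {ε : R} {p q : X × Y} :
    Near ε p q ↔ Near ε p.1 q.1 ∧ Near ε p.2 q.2 := by
  refine ⟨fun h => ⟨fun i => h (Sum.inl i), fun i => h (Sum.inr i)⟩, ?_⟩
  rintro ⟨h1, h2⟩ (i | i)
  exacts [h1 i, h2 i]

@[simp] lemma bddBy_prod {M : R} {p : X × Y} : BddBy M p ↔ BddBy M p.1 ∧ BddBy M p.2 := by
  refine ⟨fun h => ⟨fun i => h (Sum.inl i), fun i => h (Sum.inr i)⟩, ?_⟩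
  rintro ⟨h1, h2⟩ (i | i)
  exacts [h1 i, h2 i]

lemma continuous_coord_apply (i : index R X) : Continuous fun x : X => (coord x i : R) :=
  (continuous_apply i).comp (coord (R := R)).continuous

lemma isOpen_near (ε : R) (x : X) : IsOpen {y | Near ε x y} := by
  have : {y | Near ε x y} = ⋂ i : index R X, {y : X | |coord y i - coord x i| < ε} := by
    ext; simp [Near]
  rw [this]
  exact isOpen_iInter_of_finite fun i => isOpen_lt
    (((continuous_coord_apply i).sub continuous_const).abs) continuous_const

lemma isClosed_closedNear (ε : R) (x : X) : IsClosed {y | ClosedNear ε x y} := by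
  have : {y | ClosedNear ε x y} = ⋂ i : index R X, {y : X | |coord y i - coord x i| ≤ ε} := by
    ext; simp [ClosedNear]
  rw [this]
  exact isClosed_iInter fun i => isClosed_le
    (((continuous_coord_apply i).sub continuous_const).abs) continuous_const

lemma isClosed_bddBy (M : R) : IsClosed {y : X | BddBy M y} := by
  have : {y : X | BddBy M y} = ⋂ i : index R X, {y : X | |coord y i| ≤ M} := by
    ext; simp [BddBy]
  rw [this]
  exact isClosed_iInter fun i => isClosed_le (continuous_coord_apply i).abs continuous_const

lemma exists_pos_forall_le {ι : Type*} [Finite ι] (f : ι → R) (hf : ∀ i, 0 < f i) :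
    ∃ ε, 0 < ε ∧ ∀ i, ε ≤ f i := by
  cases isEmpty_or_nonempty ι
  · obtain ⟨ε, hε⟩ := exists_gt (0 : R)
    exact ⟨ε, hε, fun i => isEmptyElim i⟩
  · obtain ⟨i, hi⟩ := Finite.exists_min f
    exact ⟨f i, hf i, hi⟩

lemma exists_forall_ge {ι : Type*} [Finite ι] (f : ι → R) : ∃ M, ∀ i, f i ≤ M := by
  cases isEmpty_or_nonempty ι
  · exact ⟨0, fun i => isEmptyElim i⟩
  · obtain ⟨i, hi⟩ := Finite.exists_max f
    exact ⟨f i, hi⟩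

lemma exists_bddBy (x : X) : ∃ M : R, BddBy M x :=
  exists_forall_ge fun i : index R X => |coord x i|

lemma mem_nhds_iff_near {x : X} {U : Set X} :
    U ∈ 𝓝 x ↔ ∃ ε : R, 0 < ε ∧ ∀ y, Near ε x y → y ∈ U := by
  constructor
  · intro hU
    have h1 : (coord (R := R)).symm ⁻¹' U ∈ 𝓝 (coord (R := R) x) := by
      refine (coord (R := R)).symm.continuous.continuousAt.preimage_mem_nhds ?_
      rwa [Homeomorph.symm_apply_apply]
    rw [nhds_pi, Filter.mem_pi] at h1
    obtain ⟨I, hI, t, ht, hsub⟩ := h1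
    have h2 : ∀ i, ∃ ε : R, 0 < ε ∧ ∀ b, |b - coord x i| < ε → b ∈ t i := by
      intro i
      obtain ⟨ε, hε, h⟩ := (nhds_basis_abs_sub_lt (coord (R := R) x i)).mem_iff.1 (ht i)
      exact ⟨ε, hε, fun b hb => h hb⟩
    choose f hf hft using h2
    obtain ⟨ε, hε, hle⟩ := exists_pos_forall_le f hf
    refine ⟨ε, hε, fun y hy => ?_⟩
    have : coord (R := R) y ∈ I.pi t := fun i _ => hft i _ ((hy i).trans_le (hle i))
    simpa using hsub this
  · rintro ⟨ε, hε, h⟩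
    exact Filter.mem_of_superset ((isOpen_near ε x).mem_nhds (near_refl hε x)) h

lemma isOpen_iff_near {U : Set X} :
    IsOpen U ↔ ∀ x ∈ U, ∃ ε : R, 0 < ε ∧ ∀ y, Near ε x y → y ∈ U := by
  rw [isOpen_iff_mem_nhds]
  exact forall₂_congr fun x _ => mem_nhds_iff_near

lemma mem_interior_iff_near {x : X} {U : Set X} :
    x ∈ interior U ↔ ∃ ε : R, 0 < ε ∧ ∀ y, Near ε x y → y ∈ U := by
  rw [mem_interior_iff_mem_nhds, mem_nhds_iff_near (R := R)]

lemma exists_add_lt {ε : R} (hε : 0 < ε) : ∃ δ, 0 < δ ∧ δ + δ < ε := by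
  obtain ⟨a, ha, hae⟩ := exists_between hε
  obtain ⟨b, hb, hba⟩ := exists_between (show 0 < min a (ε - a) by simp [ha, hae])
  rw [lt_min_iff] at hba
  refine ⟨b, hb, ?_⟩
  have := add_lt_add hba.1 hba.2
  simpa using this

lemma exists_add_add_add_lt {ε : R} (hε : 0 < ε) : ∃ δ, 0 < δ ∧ δ + δ + δ + δ < ε := by
  obtain ⟨a, ha, h⟩ := exists_add_lt hε
  obtain ⟨b, hb, h'⟩ := exists_add_lt ha
  refine ⟨b, hb, ?_⟩
  have := add_lt_add h' h'
  rw [← add_assoc] at this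
  exact this.trans h

/-- Every nonempty open set contains a closed box, hence an open box around the same point. -/
lemma exists_closedNear_subset {U : Set X} (hU : IsOpen U) {x : X} (hx : x ∈ U) :
    ∃ ε : R, 0 < ε ∧ ∀ y, ClosedNear ε x y → y ∈ U := by
  obtain ⟨ε, hε, h⟩ := (mem_nhds_iff_near (R := R)).1 (hU.mem_nhds hx)
  obtain ⟨δ, hδ, hδε⟩ := exists_between hε
  exact ⟨δ, hδ, fun y hy => h y (hy.near hδε)⟩

lemma isBdd_closedNear (ε : R) (x : X) : IsBdd R {y | ClosedNear ε x y} := by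
  obtain ⟨M, hM⟩ := exists_bddBy (R := R) x
  refine ⟨ε + M, fun y hy i => ?_⟩
  have := abs_add_le (coord y i - coord x i : R) (coord x i)
  simp only [sub_add_cancel] at this
  exact this.trans (add_le_add (hy i) (hM i))

lemma IsBdd.subset {S T : Set X} (hT : IsBdd R T) (h : S ⊆ T) : IsBdd R S :=
  hT.imp fun _ hM x hx => hM x (h hx)

end Boxes

/-! ### Definable interiors, closures and extrema -/

section DefinableTopology

variable {L : Language} {R : Type u} [TopologicalSpace R] [L.Structure R] [AddCommGroup R]
  [LinearOrder R] [IsOrderedAddMonoid R] [DefinablyCompleteGroup L R]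
  [DenselyOrdered R] [Nontrivial R] [OrderTopology R]
variable {X Y Z : Type*} [TopologicalSpace X] [TopologicalSpace Y] [TopologicalSpace Z]
variable [CoordSpace R X] [CoordSpace R Y] [CoordSpace R Z]

@[fun_prop] lemma DefMap.coord {f : X → Y} (hf : DefMap L R f) (i : index R Y) :
    DefMap L R fun x => (coord (f x) i : R) := (DefMap.coord_apply i).comp hf

@[fun_prop] lemma DefMap.near {e : X → R} {f g : X → Y} (he : DefMap L R e) (hf : DefMap L R f)
    (hg : DefMap L R g) : DefPred L R fun x => Near (e x) (f x) (g x) :=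
  DefPred.forall_finite fun i => by fun_prop

@[fun_prop] lemma DefMap.closedNear {e : X → R} {f g : X → Y} (he : DefMap L R e)
    (hf : DefMap L R f) (hg : DefMap L R g) :
    DefPred L R fun x => ClosedNear (e x) (f x) (g x) :=
  DefPred.forall_finite fun i => by fun_prop

@[fun_prop] lemma DefMap.bddBy {e : X → R} {f : X → Y} (he : DefMap L R e) (hf : DefMap L R f) :
    DefPred L R fun x => BddBy (e x) (f x) :=
  DefPred.forall_finite fun i => by fun_prop

lemma DefSet.interior {S : Set X} (hS : DefSet L R S) : DefSet L R (interior S) := by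
  have : DefPred L R fun x : X => ∃ ε : R, 0 < ε ∧ ∀ y, Near ε x y → y ∈ S := by
    fun_prop (disch := assumption)
  exact this.congr_pred fun x => mem_interior_iff_near.symm

lemma DefSet.compl {S : Set X} (hS : DefSet L R S) : DefSet L R Sᶜ := DefPred.not hS

lemma DefSet.closure {S : Set X} (hS : DefSet L R S) : DefSet L R (closure S) := by
  rw [closure_eq_compl_interior_compl]
  exact hS.compl.interior.compl

lemma DefSet.inter {S T : Set X} (hS : DefSet L R S) (hT : DefSet L R T) : DefSet L R (S ∩ T) :=
  DefPred.and hS hT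

lemma DefSet.union {S T : Set X} (hS : DefSet L R S) (hT : DefSet L R T) : DefSet L R (S ∪ T) :=
  DefPred.or hS hT

lemma DefSet.diff {S T : Set X} (hS : DefSet L R S) (hT : DefSet L R T) : DefSet L R (S \ T) :=
  hS.inter hT.compl

lemma DefSet.definable₁ {S : Set R} (hS : DefSet L R S) : (univ : Set R).Definable₁ L S := by
  have : DefSet L R {x : Fin 1 → R | x 0 ∈ S} := (DefMap.apply 0).mem hS
  exact this

lemma DefSet.exists_isLUB {S : Set R} (hS : DefSet L R S) (hne : S.Nonempty) (hb : BddAbove S) :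
    ∃ s, IsLUB S s :=
  ((DefinablyCompleteGroup.complete (L := L)) S hS.definable₁ hne).1 hb

lemma DefSet.exists_isGLB {S : Set R} (hS : DefSet L R S) (hne : S.Nonempty) (hb : BddBelow S) :
    ∃ s, IsGLB S s :=
  ((DefinablyCompleteGroup.complete (L := L)) S hS.definable₁ hne).2 hb

lemma DefSet.exists_isGreatest {S : Set R} (hS : DefSet L R S) (hc : IsClosed S)
    (hne : S.Nonempty) (hb : BddAbove S) : ∃ s, IsGreatest S s := by
  obtain ⟨s, hs⟩ := hS.exists_isLUB hne hb
  exact ⟨s, by simpa [hc.closure_eq] using hs.mem_closure hne, hs.1⟩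

lemma DefSet.exists_isLeast {S : Set R} (hS : DefSet L R S) (hc : IsClosed S)
    (hne : S.Nonempty) (hb : BddBelow S) : ∃ s, IsLeast S s := by
  obtain ⟨s, hs⟩ := hS.exists_isGLB hne hb
  exact ⟨s, by simpa [hc.closure_eq] using hs.mem_closure hne, hs.1⟩

end DefinableTopology

/-! ### Definable compactness of closed bounded sets -/

section Compactness

variable {L : Language} {R : Type u} [TopologicalSpace R] [L.Structure R] [AddCommGroup R]
  [LinearOrder R] [IsOrderedAddMonoid R] [DefinablyCompleteGroup L R]
  [DenselyOrdered R] [Nontrivial R] [OrderTopology R]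
variable {X Y Z : Type*} [TopologicalSpace X] [TopologicalSpace Y] [TopologicalSpace Z]
variable [CoordSpace R X] [CoordSpace R Y] [CoordSpace R Z]

/-- A tube lemma in which a definable supremum replaces compactness of the interval: sweep upward
along the fibre and ask how high a single box around `x` avoids `C`. -/
lemma isClosed_exists_of_bounded_line {C : Set (X × R)} (hd : DefSet L R C) (hc : IsClosed C)
    {M : R} (hM : ∀ p ∈ C, |p.2| ≤ M) : IsClosed {x | ∃ y, (x, y) ∈ C} := by
  rw [← isOpen_compl_iff, isOpen_iff_near (R := R)]
  intro x hx
  simp only [mem_compl_iff, mem_ofPred_eq, not_exists] at hx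
  obtain ⟨N, hN⟩ := exists_gt (max M 0)
  obtain ⟨hMN, hN0⟩ := max_lt_iff.1 hN
  have hM' : ∀ x y, (x, y) ∈ C → |y| < N := fun x y h => (hM _ h).trans_lt hMN
  have hSd : DefPred L R fun y : R => y ≤ N ∧ ∃ δ : R, 0 < δ ∧ ∀ x' : X, ∀ z : R,
      Near δ x x' → z ≤ y → (x', z) ∉ C := by
    fun_prop (disch := assumption)
  have hne : -N ∈ {y : R | y ≤ N ∧ ∃ δ : R, 0 < δ ∧ ∀ x' : X, ∀ z : R,
      Near δ x x' → z ≤ y → (x', z) ∉ C} := by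
    refine ⟨(neg_neg_of_pos hN0).le.trans hN0.le, N, hN0, fun x' z _ hz hC => ?_⟩
    exact absurd (abs_lt.1 (hM' _ _ hC)).1 (not_lt.2 hz)
  obtain ⟨c, hcl⟩ := hSd.defSet.exists_isLUB ⟨_, hne⟩ ⟨N, fun y hy => hy.1⟩
  obtain ⟨ε, hε, hbox⟩ := mem_nhds_iff_near (R := R).1 (hc.isOpen_compl.mem_nhds (hx c))
  obtain ⟨y, ⟨hyN, δ, hδ, hy⟩, hcy, -⟩ := hcl.exists_between_sub_self hε
  have key : ∀ x' : X, ∀ z : R, Near (min ε δ) x x' → z < c + ε → (x', z) ∉ C := by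
    intro x' z hx' hz
    rcases le_or_gt z y with h | h
    · exact hy x' z (hx'.mono (min_le_right _ _)) h
    · refine hbox (x', z) (near_prod.2 ⟨hx'.mono (min_le_left _ _), near_self.2 ?_⟩)
      rw [abs_lt]
      constructor
      · have := hcy.trans h
        grind
      · exact sub_lt_iff_lt_add'.2 hz
  -- The sweep cannot stop at a height within `N`: a box around `(x, c)` missing `C` would carry it
  -- past its supremum `c`.
  have hNc : N < c + ε := by
    by_contra! hle
    obtain ⟨w, hw1, hw2⟩ := exists_between (lt_add_of_pos_right c hε)
    have : w ≤ c := hcl.1 ⟨hw2.le.trans hle, min ε δ, lt_min hε hδ, fun x' z h1 h2 =>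
      key x' z h1 (h2.trans_lt hw2)⟩
    exact absurd hw1 (not_lt.2 this)
  refine ⟨min ε δ, lt_min hε hδ, fun x' hx' => ?_⟩
  rintro ⟨z, hz⟩
  exact key x' z hx' (((le_abs_self z).trans_lt (hM' _ _ hz)).trans hNc) hz

/-- Coordinates are quantified out one at a time without changing the ambient space: `D` becomes
independent of the coordinates in `s` instead of losing them. When all are gone, the fibre can be
tested at `0`. -/
lemma isClosed_exists_of_bounded_pi {ι : Type} [Finite ι] {C : Set (X × (ι → R))}
    (hd : DefSet L R C) (hc : IsClosed C) {M : R} (hM : ∀ p ∈ C, ∀ i, |p.2 i| ≤ M) :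
    IsClosed {x | ∃ z, (x, z) ∈ C} := by
  classical
  have : Fintype ι := Fintype.ofFinite ι
  have key : ∀ s : Finset ι, ∃ D : Set (X × (ι → R)), DefSet L R D ∧ IsClosed D ∧
      (∀ p ∈ D, ∀ i ∉ s, |p.2 i| ≤ M) ∧
      (∀ x, (∃ z, (x, z) ∈ C) ↔ ∃ z, (x, z) ∈ D) ∧
      ∀ x z z', (∀ i ∉ s, z i = z' i) → (x, z) ∈ D → (x, z') ∈ D := by
    intro s
    induction s using Finset.induction with
    | empty =>
      refine ⟨C, hd, hc, fun p hp i _ => hM p hp i, fun x => Iff.rfl, fun x z z' h hz => ?_⟩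
      rwa [show z' = z from funext fun i => (h i (by simp)).symm]
    | insert j s hj ih =>
      obtain ⟨D, hDd, hDc, hDM, hDC, hDz⟩ := ih
      let E : Set ((X × (ι → R)) × R) := {q | (q.1.1, Function.update q.1.2 j q.2) ∈ D}
      have hup : DefMap L R fun q : (X × (ι → R)) × R => Function.update q.1.2 j q.2 := by
        refine DefMap.pi fun i => ?_
        by_cases h : i = j
        · subst h; simp only [Function.update_self]; fun_prop
        · simp only [Function.update_of_ne h]; fun_prop
      have hEd : DefPred L R fun q : (X × (ι → R)) × R => q ∈ E := by
        change DefPred L R fun q : (X × (ι → R)) × R => (q.1.1, Function.update q.1.2 j q.2) ∈ D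
        fun_prop (disch := assumption)
      have hEc : IsClosed E := hDc.preimage (by fun_prop)
      refine ⟨{p | ∃ a, (p, a) ∈ E}, hEd.exists.defSet, isClosed_exists_of_bounded_line (L := L)
        hEd (M := M) hEc fun q hq => ?_, ?_, fun x => ?_, ?_⟩
      · simpa using hDM _ hq j hj
      · rintro p ⟨a, ha⟩ i hi
        rw [Finset.mem_insert, not_or] at hi
        simpa [Function.update_of_ne hi.1] using hDM _ ha i hi.2
      · rw [hDC]
        constructor
        · rintro ⟨z, hz⟩
          exact ⟨z, z j, by simpa [E] using hz⟩
        · rintro ⟨z, a, ha⟩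
          exact ⟨_, ha⟩
      · rintro x z z' h ⟨a, ha⟩
        refine ⟨a, hDz x _ _ (fun i hi => ?_) ha⟩
        by_cases hij : i = j
        · subst hij; simp
        · simpa [Function.update_of_ne hij] using h i (by simp [hij, hi])
  obtain ⟨D, hDd, hDc, -, hDC, hDz⟩ := key Finset.univ
  have : {x | ∃ z, (x, z) ∈ C} = (fun x : X => (x, (0 : ι → R))) ⁻¹' D := by
    ext x
    simp only [mem_ofPred_eq, hDC, mem_preimage]
    exact ⟨fun ⟨z, hz⟩ => hDz x z 0 (by simp) hz, fun h => ⟨_, h⟩⟩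
  rw [this]
  exact hDc.preimage (by fun_prop)

/-- Projections of definable closed sets along bounded fibres are closed. -/
lemma isClosed_exists {C : Set (X × Z)} (hd : DefSet L R C) (hc : IsClosed C)
    (hM : ∃ M : R, ∀ p ∈ C, BddBy M p.2) : IsClosed {x | ∃ z, (x, z) ∈ C} := by
  obtain ⟨M, hM⟩ := hM
  let D : Set (X × (index R Z → R)) := {p | (p.1, (coord (R := R)).symm p.2) ∈ C}
  have hm : DefMap L R fun p : X × (index R Z → R) => ((coord (R := R)).symm p.2 : Z) :=
    DefMap.of_coord _ Sum.inr fun x i => by simp; rfl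
  have hDd : DefSet L R D := by
    change DefPred L R fun p : X × (index R Z → R) => (p.1, (coord (R := R)).symm p.2) ∈ C
    fun_prop (disch := assumption)
  have hDc : IsClosed D := hc.preimage (by fun_prop)
  have := isClosed_exists_of_bounded_pi hDd hDc (M := M) fun p hp i => by
    simpa using hM _ hp i
  convert this using 1
  ext x
  exact ⟨fun ⟨z, hz⟩ => ⟨coord z, by simpa [D] using hz⟩, fun ⟨z, hz⟩ => ⟨_, hz⟩⟩

/-- Images of definable closed bounded sets under continuous definable maps are closed. -/
lemma isClosed_image {C : Set Z} (hd : DefSet L R C) (hc : IsClosed C) (hb : IsBdd R C)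
    [T2Space X] {f : Z → X} (hf : DefMap L R f) (hfc : Continuous f) : IsClosed (f '' C) := by
  have h1 : DefPred L R fun p : X × Z => p.2 ∈ C ∧ f p.2 = p.1 := by
    fun_prop (disch := assumption)
  have h2 : IsClosed {p : X × Z | p.2 ∈ C ∧ f p.2 = p.1} :=
    (hc.preimage continuous_snd).inter (isClosed_eq (by fun_prop) (by fun_prop))
  obtain ⟨M, hM⟩ := hb
  exact isClosed_exists h1.defSet h2 ⟨M, fun p hp => hM _ hp.1⟩

lemma DefSet.image {C : Set Z} (hd : DefSet L R C) {f : Z → X} (hf : DefMap L R f) :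
    DefSet L R (f '' C) := by
  have h1 : DefPred L R fun p : X × Z => p.2 ∈ C ∧ f p.2 = p.1 := by
    fun_prop (disch := assumption)
  exact h1.exists

end Compactness

/-! ### Fibres in the line and the segments they contain -/

section Line

variable {L : Language} {R : Type u} [TopologicalSpace R] [L.Structure R] [AddCommGroup R]
  [LinearOrder R] [IsOrderedAddMonoid R] [DefinablyCompleteGroup L R]
  [DenselyOrdered R] [Nontrivial R] [OrderTopology R]
variable {X : Type*} [TopologicalSpace X] [CoordSpace R X]

/-- A lower semicontinuity argument: over a smaller open set, the least points of the fibres of a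
closed set lie within an interval of prescribed length. -/
lemma exists_open_fibre_near {C : Set (X × R)} (hd : DefSet L R C) (hc : IsClosed C)
    {M : R} (hM : ∀ p ∈ C, |p.2| ≤ M) {U : Set X} (hU : IsOpen U) (hUd : DefSet L R U)
    (hne : U.Nonempty) (hUC : ∀ x ∈ U, ∃ y, (x, y) ∈ C) {ε : R} (hε : 0 < ε) :
    ∃ c : R, ∃ U' ⊆ U, IsOpen U' ∧ DefSet L R U' ∧ U'.Nonempty ∧
      ∀ x ∈ U', ∃ y, (x, y) ∈ C ∧ c - ε < y ∧ y ≤ c := by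
  have hSd : DefPred L R fun y : R => ∃ x, x ∈ U ∧ (x, y) ∈ C ∧ ∀ y', y' < y → (x, y') ∉ C := by
    fun_prop (disch := assumption)
  have hmin : ∀ x ∈ U, ∃ y, (x, y) ∈ C ∧ ∀ y', y' < y → (x, y') ∉ C := by
    intro x hx
    have h1 : DefPred L R fun y : R => (x, y) ∈ C := by fun_prop (disch := assumption)
    obtain ⟨y, hy, hy'⟩ := h1.defSet.exists_isLeast (hc.preimage (by fun_prop)) (hUC x hx)
      ⟨-M, fun y hy => (abs_le.1 (hM _ hy)).1⟩
    exact ⟨y, hy, fun y' h h' => absurd h (not_lt.2 (hy' h'))⟩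
  obtain ⟨x₀, hx₀⟩ := hne
  obtain ⟨c, hcl⟩ := hSd.defSet.exists_isLUB
    (by obtain ⟨y, h1, h2⟩ := hmin x₀ hx₀; exact ⟨y, x₀, hx₀, h1, h2⟩)
    ⟨M, by rintro y ⟨x, hx, hy, -⟩; exact (abs_le.1 (hM _ hy)).2⟩
  obtain ⟨y₁, ⟨x₁, hx₁, h1, h2⟩, hcy, -⟩ := hcl.exists_between_sub_self hε
  have hDd : DefPred L R fun p : X × R => p ∈ C ∧ p.2 ≤ c - ε := by
    fun_prop (disch := assumption)
  -- Here `c` is the supremum of the least fibre points. Having a fibre point at or below `c - ε` is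
  -- a closed condition on `x`, by compactness; discarding it leaves an open set, nonempty because
  -- some least point exceeds `c - ε`.
  have hDc : IsClosed {p : X × R | p ∈ C ∧ p.2 ≤ c - ε} :=
    hc.inter (isClosed_le continuous_snd continuous_const)
  have hD := isClosed_exists_of_bounded_line hDd.defSet hDc (M := M) fun p hp => hM p hp.1
  refine ⟨c, U ∩ {x | ∃ y, (x, y) ∈ C ∧ y ≤ c - ε}ᶜ, inter_subset_left,
    hU.inter hD.isOpen_compl, hUd.inter (DefPred.exists hDd).defSet.compl, ⟨x₁, hx₁, ?_⟩, ?_⟩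
  · rintro ⟨y, hy, hyc⟩
    exact h2 y (hyc.trans_lt hcy) hy
  · rintro x ⟨hx, hx'⟩
    obtain ⟨y, h1, h2⟩ := hmin x hx
    refine ⟨y, h1, ?_, hcl.1 ⟨x, hx, h1, h2⟩⟩
    by_contra! h
    exact hx' ⟨y, h1, h⟩

lemma isClosed_segment {C : Set (X × R)} (hc : IsClosed C) (t : R) :
    IsClosed {p : X × R | ∀ y, p.2 ≤ y → y ≤ p.2 + t → (p.1, y) ∈ C} := by
  have : {p : X × R | ∀ y, p.2 ≤ y → y ≤ p.2 + t → (p.1, y) ∈ C} =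
      ⋂ u : Icc (0 : R) t, (fun p : X × R => (p.1, p.2 + u)) ⁻¹' C := by
    ext p
    simp only [mem_ofPred_eq, mem_iInter, mem_preimage, Subtype.forall, mem_Icc]
    constructor
    · rintro h u ⟨h1, h2⟩
      exact h _ (by simpa) (by simpa)
    · intro h y h1 h2
      have := h (y - p.2) ⟨by simpa, by grind⟩
      simpa using this
  rw [this]
  exact isClosed_iInter fun u => hc.preimage (by fun_prop)

/-- The set of points whose fibre contains a segment of length `t`. -/
def segmentBase (C : Set (X × R)) (t : R) : Set X :=
  {x | ∃ a, ∀ y, a ≤ y → y ≤ a + t → (x, y) ∈ C}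

lemma isClosed_segmentBase {C : Set (X × R)} (hd : DefSet L R C) (hc : IsClosed C)
    {M : R} (hM : ∀ p ∈ C, |p.2| ≤ M) {t : R} (ht : 0 < t) : IsClosed (segmentBase C t) := by
  have hd' : DefPred L R fun p : X × R => ∀ y, p.2 ≤ y → y ≤ p.2 + t → (p.1, y) ∈ C := by
    fun_prop (disch := assumption)
  exact isClosed_exists_of_bounded_line hd'.defSet (isClosed_segment hc t) (M := M)
    fun p hp => hM (p.1, p.2) (hp p.2 le_rfl (by simpa using ht.le))

lemma DefSet.segmentBase {C : Set (X × R)} (hd : DefSet L R C) (t : R) :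
    DefSet L R (segmentBase C t) := by
  have hd' : DefPred L R fun x : X => ∃ a, ∀ y, a ≤ y → y ≤ a + t → (x, y) ∈ C := by
    fun_prop (disch := assumption)
  exact hd'

/-- If the fibres over an open set contained segments of length `t`, the lower endpoints could be
confined to `(c - h, c]` over a smaller open set. With `2h < t` all these segments contain `(c, c +
h)`, so `C` would contain an open box. -/
lemma interior_segmentBase {C : Set (X × R)} (hd : DefSet L R C) (hc : IsClosed C)
    {M : R} (hM : ∀ p ∈ C, |p.2| ≤ M) (hint : interior C = ∅) {t : R} (ht : 0 < t) :
    interior (segmentBase C t) = ∅ := by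
  by_contra hne
  rw [← Ne, ← nonempty_iff_ne_empty] at hne
  have hd' : DefPred L R fun p : X × R => ∀ y, p.2 ≤ y → y ≤ p.2 + t → (p.1, y) ∈ C := by
    fun_prop (disch := assumption)
  obtain ⟨h, hh, hht⟩ := exists_add_lt ht
  obtain ⟨c, U, -, hUo, -, ⟨x₀, hx₀⟩, hU⟩ := exists_open_fibre_near hd'.defSet
    (isClosed_segment hc t) (M := M)
    (fun p hp => hM (p.1, p.2) (hp p.2 le_rfl (by simpa using ht.le))) isOpen_interior
    (hd.segmentBase t).interior hne (fun x hx => show x ∈ segmentBase C t from interior_subset hx) hh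
  have hsub : U ×ˢ Ioo c (c + h) ⊆ C := by
    rintro ⟨x, y⟩ ⟨hx, hy1, hy2⟩
    obtain ⟨a, ha, h1, h2⟩ := hU x hx
    exact ha y (h2.trans hy1.le) (by simp only at *; grind)
  obtain ⟨y, hy⟩ := exists_between (lt_add_of_pos_right c hh)
  have : (x₀, y) ∈ interior C := interior_maximal hsub (hUo.prod isOpen_Ioo) ⟨hx₀, hy⟩
  rw [hint] at this
  exact this

end Line

/-! ### Pseudo-finite subsets of the line and their gaps -/

section PseudoFinite

/-- Every definable closed subset of the line is discrete or contains an interval. -/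
class DiscreteOrInterval (L : Language) (R : Type u) [L.Structure R] [LinearOrder R]
    [TopologicalSpace R] : Prop where
  out : DefinableClosedSetsDiscreteOrContainInterval L R

/-- A definable closed bounded subset of the line without interior. -/
structure PseudoFinite (L : Language) {R : Type u} [L.Structure R] [AddCommGroup R] [LinearOrder R]
    [TopologicalSpace R] (D : Set R) : Prop where
  defSet : DefSet L R D
  isClosed : IsClosed D
  isBdd : IsBdd R D
  interior_eq : interior D = ∅

variable {L : Language} {R : Type u} [TopologicalSpace R] [L.Structure R] [AddCommGroup R]
  [LinearOrder R] [IsOrderedAddMonoid R] [DefinablyCompleteGroup L R]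
  [DenselyOrdered R] [Nontrivial R] [OrderTopology R]

lemma interior_eq_empty_iff_Ioo {D : Set R} :
    interior D = ∅ ↔ ∀ a b, a < b → ¬ Ioo a b ⊆ D := by
  constructor
  · intro h a b hab hsub
    have h1 := interior_maximal hsub isOpen_Ioo
    rw [h, subset_empty_iff] at h1
    exact (nonempty_Ioo.2 hab).ne_empty h1
  · intro h
    by_contra hne
    obtain ⟨x, hx⟩ := nonempty_iff_ne_empty.2 hne
    obtain ⟨l, u, hlu, hsub⟩ := mem_nhds_iff_exists_Ioo_subset.1 (isOpen_interior.mem_nhds hx)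
    exact h l u (hlu.1.trans hlu.2) (hsub.trans interior_subset)

lemma isBdd_line {D : Set R} : IsBdd R D ↔ ∃ M, ∀ x ∈ D, |x| ≤ M := by
  simp [IsBdd]

lemma isBdd_of_Icc {D : Set R} {a b : R} (h : D ⊆ Icc a b) : IsBdd R D :=
  isBdd_line.2 ⟨max |a| |b|, fun _ hx => abs_le_max_abs_abs (h hx).1 (h hx).2⟩

lemma IsBdd.bddAbove {D : Set R} (h : IsBdd R D) : BddAbove D := by
  obtain ⟨M, hM⟩ := isBdd_line.1 h
  exact ⟨M, fun x hx => (abs_le.1 (hM x hx)).2⟩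

lemma IsBdd.bddBelow {D : Set R} (h : IsBdd R D) : BddBelow D := by
  obtain ⟨M, hM⟩ := isBdd_line.1 h
  exact ⟨-M, fun x hx => (abs_le.1 (hM x hx)).1⟩

lemma interior_union_eq_empty_of_closed {D E : Set R} (hE : IsClosed E)
    (hDi : interior D = ∅) (hEi : interior E = ∅) : interior (D ∪ E) = ∅ := by
  rw [union_comm, interior_union_isClosed_of_interior_empty hE hDi, hEi]

namespace PseudoFinite

variable [DiscreteOrInterval L R]

lemma discreteTopology {D : Set R} (hD : PseudoFinite L D) : DiscreteTopology D := by
  rcases DiscreteOrInterval.out D hD.defSet.definable₁ hD.isClosed with h | ⟨a, b, hab, h⟩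
  · exact h
  · exact absurd h (interior_eq_empty_iff_Ioo.1 hD.interior_eq a b (nonempty_Ioo.1 hab))

lemma isClosed_of_subset {D E : Set R} (hD : PseudoFinite L D) (h : E ⊆ D) : IsClosed E := by
  have := hD.discreteTopology
  have h1 : IsClosed ((↑) ⁻¹' E : Set D) := isClosed_discrete _
  have h2 := hD.isClosed.isClosedEmbedding_subtypeVal.isClosedMap _ h1
  rwa [Subtype.image_preimage_coe, inter_eq_self_of_subset_right h] at h2

/-- Closed discrete sets have no accumulation points, so all their subsets are closed. Nonempty
definable subsets therefore have least and greatest elements, which permits induction along a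
pseudo-finite set as along a finite one. -/
lemma subset {D E : Set R} (hD : PseudoFinite L D) (hE : DefSet L R E) (h : E ⊆ D) :
    PseudoFinite L E :=
  ⟨hE, hD.isClosed_of_subset h, hD.isBdd.subset h,
    subset_empty_iff.1 (hD.interior_eq ▸ interior_mono h)⟩

lemma exists_isLeast {D : Set R} (hD : PseudoFinite L D) (hne : D.Nonempty) :
    ∃ x, IsLeast D x :=
  hD.defSet.exists_isLeast hD.isClosed hne hD.isBdd.bddBelow

lemma exists_isGreatest {D : Set R} (hD : PseudoFinite L D) (hne : D.Nonempty) :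
    ∃ x, IsGreatest D x :=
  hD.defSet.exists_isGreatest hD.isClosed hne hD.isBdd.bddAbove

/-- A pseudo-finite union of closed sets without interior has no interior. -/
lemma interior_biUnion {D : Set R} (hD : PseudoFinite L D) {E : Set (R × R)} (hE : DefSet L R E)
    (hEc : ∀ d ∈ D, IsClosed {x | (d, x) ∈ E}) (hEi : ∀ d ∈ D, interior {x | (d, x) ∈ E} = ∅) :
    interior {x | ∃ d ∈ D, (d, x) ∈ E} = ∅ := by
  have hDd := hD.defSet
  let U : R → Set R := fun t => {x | ∃ d ∈ D, d ≤ t ∧ (d, x) ∈ E}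
  have hPd : DefPred L R fun t : R => t ∈ D ∧ ∃ a b : R, a < b ∧ ∀ x : R, a < x ∧ x < b →
      ∃ d, d ∈ D ∧ d ≤ t ∧ (d, x) ∈ E := by
    fun_prop (disch := assumption)
  have hP : ∀ t ∈ D, interior (U t) = ∅ := by
    by_contra! hne
    obtain ⟨t, ht, htne⟩ := hne
    have hPne : {t : R | t ∈ D ∧ ∃ a b : R, a < b ∧ ∀ x : R, a < x ∧ x < b →
      ∃ d, d ∈ D ∧ d ≤ t ∧ (d, x) ∈ E}.Nonempty := by
      have := (not_congr (interior_eq_empty_iff_Ioo (D := U t))).1 htne.ne_empty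
      push Not at this
      obtain ⟨a, b, hab, hsub⟩ := this
      exact ⟨t, ht, a, b, hab, fun x hx => hsub hx⟩
    -- Induction along `D`: take the least index at which the partial union acquires interior and
    -- compare it with its predecessor `t₁`, if there is one. Only the single closed set over `t₀`
    -- is added.
    obtain ⟨t₀, ⟨ht₀, a, b, hab, hsub⟩, hmin⟩ :=
      (hD.subset hPd.defSet fun t ht => ht.1).exists_isLeast hPne
    have hQd : DefPred L R fun t : R => t ∈ D ∧ t < t₀ := by fun_prop (disch := assumption)
    by_cases hQ : {t : R | t ∈ D ∧ t < t₀}.Nonempty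
    · obtain ⟨t₁, ⟨ht₁, ht₁₀⟩, hmax⟩ := (hD.subset hQd.defSet fun t ht => ht.1).exists_isGreatest hQ
      have h1 : interior (U t₁) = ∅ := by
        by_contra hne
        have := (not_congr (interior_eq_empty_iff_Ioo (D := U t₁))).1 hne
        push Not at this
        obtain ⟨a, b, hab, hsub⟩ := this
        exact absurd (hmin ⟨ht₁, a, b, hab, fun x hx => hsub hx⟩) (not_le.2 ht₁₀)
      have h2 := interior_union_eq_empty_of_closed (hEc t₀ ht₀) h1 (hEi t₀ ht₀)
      refine interior_eq_empty_iff_Ioo.1 h2 a b hab fun x hx => ?_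
      obtain ⟨d, hd, hdt, hdE⟩ := hsub x hx
      rcases hdt.lt_or_eq with h | rfl
      · exact Or.inl ⟨d, hd, hmax ⟨hd, h⟩, hdE⟩
      · exact Or.inr hdE
    · refine interior_eq_empty_iff_Ioo.1 (hEi t₀ ht₀) a b hab fun x hx => ?_
      obtain ⟨d, hd, hdt, hdE⟩ := hsub x hx
      rcases hdt.lt_or_eq with h | rfl
      · exact absurd ⟨d, hd, h⟩ hQ
      · exact hdE
  rcases D.eq_empty_or_nonempty with rfl | hne
  · simp
  · obtain ⟨t, ht, hmax⟩ := hD.exists_isGreatest hne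
    convert hP t ht using 2
    ext x
    exact ⟨fun ⟨d, hd, h⟩ => ⟨d, hd, hmax hd, h⟩, fun ⟨d, hd, _, h⟩ => ⟨d, hd, h⟩⟩

/-- Closedness is compactness. For the interior, the difference set is the union over `d ∈ D` of the
translates `D - d`, a pseudo-finite union of closed sets without interior. -/
lemma sub {D : Set R} (hD : PseudoFinite L D) :
    PseudoFinite L {t | ∃ d ∈ D, t + d ∈ D} := by
  have hDd := hD.defSet
  obtain ⟨M, hM⟩ := isBdd_line.1 hD.isBdd
  have hd : DefPred L R fun p : R × R => p.2 ∈ D ∧ p.1 + p.2 ∈ D := by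
    fun_prop (disch := assumption)
  refine ⟨DefPred.exists hd, ?_, isBdd_line.2 ⟨M + M, ?_⟩, ?_⟩
  · exact isClosed_exists_of_bounded_line hd.defSet
      ((hD.isClosed.preimage continuous_snd).inter
        (hD.isClosed.preimage (continuous_fst.add continuous_snd))) (M := M)
      fun p hp => hM _ hp.1
  · rintro t ⟨d, hd, htd⟩
    have h1 := abs_le.1 (hM _ hd)
    have h2 := abs_le.1 (hM _ htd)
    rw [abs_le]
    grind
  · have hE : DefPred L R fun p : R × R => p.2 + p.1 ∈ D := by fun_prop (disch := assumption)
    refine hD.interior_biUnion hE.defSet (fun d _ => ?_) fun d _ => ?_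
    · exact hD.isClosed.preimage (continuous_id.add continuous_const)
    · rw [interior_eq_empty_iff_Ioo]
      intro a b hab hsub
      refine interior_eq_empty_iff_Ioo.1 hD.interior_eq (a + d) (b + d) (by simpa) fun x hx => ?_
      have : x - d ∈ Ioo a b := ⟨lt_sub_iff_add_lt.2 hx.1, sub_lt_iff_lt_add.2 hx.2⟩
      simpa using hsub this

/-- The points of a set are pairwise at distance at least `s`. -/
def _root_.Separated (s : R) (D : Set R) : Prop := ∀ x ∈ D, ∀ y ∈ D, x < y → s ≤ y - x

/-- The least distance of two points of a pseudo-finite set is attained. -/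
lemma exists_min_gap {D : Set R} (hD : PseudoFinite L D) {x y : R} (hx : x ∈ D) (hy : y ∈ D)
    (hxy : x < y) : ∃ u ∈ D, ∃ v ∈ D, u < v ∧ Separated (v - u) D := by
  have hDd := hD.defSet
  have hGd : DefPred L R fun t : R => 0 < t ∧ ∃ d, d ∈ D ∧ t + d ∈ D := by
    fun_prop (disch := assumption)
  obtain ⟨t, ⟨ht, u, hu, hv⟩, hmin⟩ := (hD.sub.subset hGd.defSet fun t ht => ht.2).exists_isLeast
    ⟨y - x, sub_pos.2 hxy, x, hx, by simpa⟩
  exact ⟨u, hu, t + u, hv, by simpa, fun x hx y hy hxy => by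
    simpa using hmin ⟨sub_pos.2 hxy, x, hx, by simpa⟩⟩

lemma exists_separated {D : Set R} (hD : PseudoFinite L D) : ∃ s : R, 0 < s ∧ Separated s D := by
  by_cases h : ∃ x ∈ D, ∃ y ∈ D, x < y
  · obtain ⟨x, hx, y, hy, hxy⟩ := h
    obtain ⟨u, -, v, -, huv, hs⟩ := hD.exists_min_gap hx hy hxy
    exact ⟨v - u, sub_pos.2 huv, hs⟩
  · push Not at h
    obtain ⟨s, hs⟩ := exists_gt (0 : R)
    exact ⟨s, hs, fun x hx y hy hxy => absurd hxy (not_lt.2 (h x hx y hy))⟩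

end PseudoFinite

variable [DiscreteOrInterval L R]

/-- An increasing definable chain of pseudo-finite sets is uniformly separated. -/
lemma exists_separated_of_chain {J : Set R} (hJ : DefSet L R J) {F : Set (R × R)}
    (hF : DefSet L R F) (hmono : ∀ r ∈ J, ∀ r' ∈ J, r ≤ r' → ∀ x, (x, r) ∈ F → (x, r') ∈ F)
    (hpf : ∀ r ∈ J, PseudoFinite L {x | (x, r) ∈ F}) :
    ∃ s : R, 0 < s ∧ ∀ r ∈ J, Separated s {x | (x, r) ∈ F} := by
  by_contra! hcon
  -- `Δ` collects, over all stages `r`, the least positive distance within the stage. If separation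
  -- is not uniform, `Δ` has arbitrarily small elements.
  have hΔd : DefPred L R fun g : R => 0 < g ∧ ∃ r : R, r ∈ J ∧ (∃ u : R, (u, r) ∈ F ∧
      (g + u, r) ∈ F) ∧ ∀ x y : R, (x, r) ∈ F → (y, r) ∈ F → x < y → g ≤ y - x := by
    fun_prop (disch := assumption)
  set Δ : Set R := {g : R | 0 < g ∧ ∃ r : R, r ∈ J ∧ (∃ u : R, (u, r) ∈ F ∧
      (g + u, r) ∈ F) ∧ ∀ x y : R, (x, r) ∈ F → (y, r) ∈ F → x < y → g ≤ y - x} with hΔ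
  have hsmall : ∀ s : R, 0 < s → ∃ g ∈ Δ, g < s := by
    intro s hs
    obtain ⟨r, hr, hsep⟩ := hcon s hs
    simp only [Separated, not_forall, not_le] at hsep
    obtain ⟨x, hx, y, hy, hxy, hlt⟩ := hsep
    obtain ⟨u, hu, v, hv, huv, hmin⟩ := (hpf r hr).exists_min_gap hx hy hxy
    refine ⟨v - u, ⟨sub_pos.2 huv, r, hr, ⟨u, hu, by simpa using hv⟩, fun x y hx hy hxy =>
      hmin x hx y hy hxy⟩, (hmin x hx y hy hxy).trans_lt hlt⟩
  -- The closure of `Δ` has 0 as an accumulation point, so it is not discrete and must contain an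
  -- interval; that interval lies in the nonnegative half-line and is shrunk to make `a` positive.
  have hint : ∃ a b : R, 0 < a ∧ a < b ∧ Ioo a b ⊆ closure Δ := by
    rcases DiscreteOrInterval.out _ (DefSet.closure (R := R) (S := Δ) hΔd).definable₁
      isClosed_closure with h | ⟨a, b, hab, h⟩
    · exfalso
      have h0 : (0 : R) ∈ closure Δ := by
        rw [mem_closure_iff_nhds]
        intro t ht
        obtain ⟨ε, hε, h⟩ := mem_nhds_iff_near (R := R).1 ht
        obtain ⟨g, hg, hgε⟩ := hsmall ε hε
        exact ⟨g, h g (by simpa [abs_of_pos hg.1] using hgε), hg⟩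
      have h1 := (isOpen_discrete ({⟨0, h0⟩} : Set (closure Δ)))
      rw [isOpen_induced_iff] at h1
      obtain ⟨V, hV, hV0⟩ := h1
      have h0V : (0 : R) ∈ V := by
        have : (⟨0, h0⟩ : closure Δ) ∈ ((↑) ⁻¹' V : Set (closure Δ)) := by rw [hV0]; rfl
        exact this
      obtain ⟨ε, hε, h⟩ := mem_nhds_iff_near (R := R).1 (hV.mem_nhds h0V)
      obtain ⟨g, hg, hgε⟩ := hsmall ε hε
      have : (⟨g, subset_closure hg⟩ : closure Δ) ∈ ((↑) ⁻¹' V : Set (closure Δ)) :=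
        h g (by simpa [abs_of_pos hg.1] using hgε)
      rw [hV0] at this
      exact hg.1.ne' (congrArg Subtype.val this)
    · rw [nonempty_Ioo] at hab
      obtain ⟨a', ha', hb'⟩ := exists_between hab
      refine ⟨a', b, ?_, hb', (Ioo_subset_Ioo_left ha'.le).trans h⟩
      have ha0 : 0 ≤ a := by
        by_contra! h0
        obtain ⟨c, hc1, hc2⟩ := exists_between (lt_min hab h0)
        rw [lt_min_iff] at hc2
        have h3 : closure Δ ⊆ Ici 0 := closure_minimal (fun g hg => hg.1.le) isClosed_Ici
        exact absurd (h3 (h ⟨hc1, hc2.1⟩)) (not_le.2 hc2.2)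
      exact ha0.trans_lt ha'
  obtain ⟨a, b, ha, hab, hsub⟩ := hint
  -- Stage `r₀` already has a gap below `a`, as do all later stages. Least gaps in `(a, b)` thus
  -- come from earlier stages and are differences of points of stage `r₀`. They are dense in `(a,
  -- b)`, but the difference set is closed without interior.
  obtain ⟨r₀, hr₀, hsep⟩ := hcon a ha
  simp only [Separated, not_forall, not_le] at hsep
  obtain ⟨x, hx, y, hy, hxy, hlt⟩ := hsep
  have hD := (hpf r₀ hr₀).sub
  refine interior_eq_empty_iff_Ioo.1 hD.interior_eq a b hab ?_
  have h1 : Ioo a b ∩ Δ ⊆ {t | ∃ d ∈ {x | (x, r₀) ∈ F}, t + d ∈ {x | (x, r₀) ∈ F}} := by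
    rintro g ⟨⟨hga, -⟩, -, r, hr, ⟨u, hu, hv⟩, hmin⟩
    have hrr : r ≤ r₀ := by
      by_contra! h
      have := hmin x y (hmono _ hr₀ _ hr h.le _ hx) (hmono _ hr₀ _ hr h.le _ hy) hxy
      exact absurd (this.trans_lt hlt) (not_lt.2 hga.le)
    exact ⟨u, hmono _ hr _ hr₀ hrr _ hu, hmono _ hr _ hr₀ hrr _ hv⟩
  intro g hg
  have h2 : g ∈ closure (Ioo a b ∩ Δ) := isOpen_Ioo.inter_closure ⟨hg, hsub hg⟩
  exact closure_minimal h1 hD.isClosed h2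

end PseudoFinite

/-! ### Σ-families and the Baire property on the line -/

section SigmaFamilies

variable {L : Language} {R : Type u} [TopologicalSpace R] [L.Structure R] [AddCommGroup R]
  [LinearOrder R] [IsOrderedAddMonoid R] [DefinablyCompleteGroup L R]
  [DenselyOrdered R] [Nontrivial R] [OrderTopology R]
variable {X Y Z : Type*} [TopologicalSpace X] [TopologicalSpace Y] [TopologicalSpace Z]
variable [CoordSpace R X] [CoordSpace R Y] [CoordSpace R Z]

/-- The member of a two-parameter family with parameters `r` and `s`. -/
def slice {R X : Type*} (F : Set (X × R × R)) (r s : R) : Set X := {x | (x, r, s) ∈ F}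

/-- The union of a two-parameter family over all `r` and all positive `s`. -/
def total {R X : Type*} [Zero R] [LT R] (F : Set (X × R × R)) : Set X :=
  {x | ∃ r s : R, 0 < s ∧ (x, r, s) ∈ F}

/-- A definable family of closed bounded sets, increasing in `r` and decreasing in `s > 0`. -/
structure SigmaFam (L : Language) {R : Type u} [TopologicalSpace R] [L.Structure R]
    [AddCommGroup R] [LinearOrder R] {X : Type*} [TopologicalSpace X] [CoordSpace R X]
    (F : Set (X × R × R)) : Prop where
  defSet : DefSet L R F
  isClosed : ∀ r s, 0 < s → IsClosed (slice F r s)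
  isBdd : ∀ r s, 0 < s → IsBdd R (slice F r s)
  mono : ∀ {r r' s s' : R}, r ≤ r' → 0 < s' → s' ≤ s → slice F r s ⊆ slice F r' s'

variable (L R X) in
/-- The union of a definable family of closed bounded sets without interior is nowhere dense. -/
class DefinablyBaire : Prop where
  exists_open : ∀ F : Set (X × R × R), SigmaFam L F →
    (∀ r s, 0 < s → interior (slice F r s) = ∅) → ∀ U : Set X, IsOpen U → U.Nonempty →
      ∃ U' ⊆ U, IsOpen U' ∧ U'.Nonempty ∧ ∀ x ∈ U', x ∉ total F

lemma DefSet.near (ε : R) (x : X) : DefSet L R {y | Near ε x y} := by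
  have : DefPred L R fun y : X => Near ε x y := by fun_prop
  exact this

lemma DefSet.slice {F : Set (X × R × R)} (hF : DefSet L R F) (r s : R) :
    DefSet L R (slice F r s) := by
  have : DefPred L R fun x : X => (x, r, s) ∈ F := by fun_prop (disch := assumption)
  exact this

lemma DefSet.total {F : Set (X × R × R)} (hF : DefSet L R F) : DefSet L R (total F) := by
  have : DefPred L R fun x : X => ∃ r s : R, 0 < s ∧ (x, r, s) ∈ F := by
    fun_prop (disch := assumption)
  exact this

lemma exists_definable_open_subset {U : Set X} (hU : IsOpen U) (hne : U.Nonempty) :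
    ∃ V ⊆ U, IsOpen V ∧ DefSet L R V ∧ V.Nonempty := by
  obtain ⟨x, hx⟩ := hne
  obtain ⟨ε, hε, h⟩ := mem_nhds_iff_near (R := R).1 (hU.mem_nhds hx)
  exact ⟨_, h, isOpen_near ε x, .near ε x, x, near_refl hε x⟩

lemma SigmaFam.of_antitone {F : Set (X × R)} (hF : DefSet L R F)
    (hc : ∀ s, 0 < s → IsClosed {x | (x, s) ∈ F}) (hb : ∀ s, 0 < s → IsBdd R {x | (x, s) ∈ F})
    (hm : ∀ s s', 0 < s' → s' ≤ s → ∀ x, (x, s) ∈ F → (x, s') ∈ F) :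
    SigmaFam L {p : X × R × R | (p.1, p.2.2) ∈ F} := by
  refine ⟨?_, fun r s hs => hc s hs, fun r s hs => hb s hs, fun _ hs' hss x hx => hm _ _ hs' hss _ hx⟩
  have : DefPred L R fun p : X × R × R => (p.1, p.2.2) ∈ F := by fun_prop (disch := assumption)
  exact this

lemma DefinablyBaire.exists_interior_nonempty [DefinablyBaire L R X] {F : Set (X × R × R)}
    (hF : SigmaFam L F) {U : Set X} (hU : IsOpen U) (hne : U.Nonempty) (hUF : U ⊆ total F) :
    ∃ r s, 0 < s ∧ (interior (slice F r s)).Nonempty := by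
  by_contra! h
  obtain ⟨V, hVU, -, ⟨x, hx⟩, hV⟩ := DefinablyBaire.exists_open F hF h U hU hne
  exact hV x hx (hUF (hVU hx))

/-- The Baire property for a family depending on one parameter only. -/
lemma DefinablyBaire.exists_interior_nonempty_of_antitone [DefinablyBaire L R X]
    {F : Set (X × R)} (hF : DefSet L R F)
    (hc : ∀ s, 0 < s → IsClosed {x | (x, s) ∈ F}) (hb : ∀ s, 0 < s → IsBdd R {x | (x, s) ∈ F})
    (hm : ∀ s s', 0 < s' → s' ≤ s → ∀ x, (x, s) ∈ F → (x, s') ∈ F)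
    {U : Set X} (hU : IsOpen U) (hne : U.Nonempty) (hUF : ∀ x ∈ U, ∃ s, 0 < s ∧ (x, s) ∈ F) :
    ∃ s, 0 < s ∧ (interior {x | (x, s) ∈ F}).Nonempty := by
  obtain ⟨r, s, hs, h⟩ := exists_interior_nonempty (SigmaFam.of_antitone hF hc hb hm) hU hne
    fun x hx => by
      obtain ⟨s, hs, h⟩ := hUF x hx
      exact ⟨0, s, hs, h⟩
  exact ⟨s, hs, h⟩

lemma SigmaFam.inter_closed {F : Set (X × R × R)} (hF : SigmaFam L F) {C : Set X}
    (hC : DefSet L R C) (hCc : IsClosed C) : SigmaFam L {p : X × R × R | p ∈ F ∧ p.1 ∈ C} := by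
  have hFd := hF.defSet
  have : DefPred L R fun p : X × R × R => p ∈ F ∧ p.1 ∈ C := by fun_prop (disch := assumption)
  exact ⟨this, fun r s hs => (hF.isClosed r s hs).inter hCc,
    fun r s hs => (hF.isBdd r s hs).subset inter_subset_left,
    fun hr hs' hs x hx => ⟨hF.mono hr hs' hs hx.1, hx.2⟩⟩

/-- A union of a definable family of closed bounded sets that is dense in an open set contains
a smaller open set. -/
lemma DefinablyBaire.exists_open_subset [DefinablyBaire L R X] {F : Set (X × R × R)}
    (hF : SigmaFam L F) {U : Set X} (hU : IsOpen U) (hne : U.Nonempty)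
    (hd : ∀ V ⊆ U, IsOpen V → V.Nonempty → ∃ x ∈ V, x ∈ total F) :
    ∃ V ⊆ U, IsOpen V ∧ DefSet L R V ∧ V.Nonempty ∧ V ⊆ total F := by
  obtain ⟨x, hx⟩ := hne
  obtain ⟨ε, hε, h⟩ := exists_closedNear_subset (R := R) hU hx
  have hCd : DefPred L R fun y : X => ClosedNear ε x y := by fun_prop
  -- Cutting the family down to a closed box inside `U` ensures that a slice with interior yields an
  -- open set within `U`.
  have hF' := hF.inter_closed hCd.defSet (isClosed_closedNear ε x)
  by_cases hint : ∀ r s, 0 < s → interior (slice {p : X × R × R | p ∈ F ∧ p.1 ∈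
      {y | ClosedNear ε x y}} r s) = ∅
  · exfalso
    obtain ⟨V, hV, hVo, hVne, hVF⟩ := DefinablyBaire.exists_open _ hF' hint _ (isOpen_near ε x)
      ⟨x, near_refl hε x⟩
    obtain ⟨y, hy, r, s, hs, hyF⟩ := hd V (fun y hy => h y (hV hy).closedNear) hVo hVne
    exact hVF y hy ⟨r, s, hs, hyF, (hV hy).closedNear⟩
  · push Not at hint
    obtain ⟨r, s, hs, hne⟩ := hint
    exact ⟨_, fun y hy => h y (interior_subset hy).2, isOpen_interior,
      (hF'.defSet.slice r s).interior, hne, fun y hy => ⟨r, s, hs, (interior_subset hy).1⟩⟩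

lemma DefSet.fibre {S : Set (X × Y)} (hS : DefSet L R S) (x : X) :
    DefSet L R {y | (x, y) ∈ S} := by
  have : DefPred L R fun y : Y => (x, y) ∈ S := by fun_prop (disch := assumption)
  exact this

lemma SigmaFam.fibre {F : Set ((X × Y) × R × R)} (hF : SigmaFam L F) (x : X) :
    SigmaFam L {p : Y × R × R | ((x, p.1), p.2) ∈ F} := by
  have hFd := hF.defSet
  have : DefPred L R fun p : Y × R × R => ((x, p.1), p.2) ∈ F := by fun_prop (disch := assumption)
  refine ⟨this, fun r s hs => (hF.isClosed r s hs).preimage (by fun_prop), fun r s hs => ?_,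
    fun hr hs' hs y hy => hF.mono hr hs' hs hy⟩
  obtain ⟨M, hM⟩ := hF.isBdd r s hs
  exact ⟨M, fun y hy => (bddBy_prod.1 (hM _ hy)).2⟩

instance definablyBaire_punit : DefinablyBaire L R PUnit.{v + 1} where
  exists_open F _ hint U hU hne := by
    refine ⟨U, Subset.rfl, hU, hne, ?_⟩
    rintro x - ⟨r, s, hs, h⟩
    have h1 : interior (slice F r s) = univ := by
      rw [show slice F r s = univ from eq_univ_of_forall fun y => h, interior_univ]
    rw [hint r s hs] at h1
    exact (h1 ▸ mem_univ x : x ∈ (∅ : Set PUnit))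

lemma Separated.subset {D E : Set R} {s : R} (h : Separated s E) (hDE : D ⊆ E) : Separated s D :=
  fun x hx y hy => h x (hDE hx) y (hDE hy)

lemma Separated.isClosed {D : Set R} {s : R} (hs : 0 < s) (h : Separated s D) : IsClosed D := by
  rw [← isOpen_compl_iff, isOpen_iff_near (R := R)]
  intro x hx
  obtain ⟨δ, hδ, hδs⟩ := exists_add_lt hs
  by_cases hex : ∃ y ∈ D, |y - x| < δ
  · obtain ⟨y, hy, hyx⟩ := hex
    have hne : y ≠ x := fun h => hx (h ▸ hy)
    refine ⟨min δ |y - x|, lt_min hδ (abs_pos.2 (sub_ne_zero.2 hne)), fun z hz hzD => ?_⟩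
    rw [near_self, lt_min_iff] at hz
    have hzy : z ≠ y := fun h => by rw [h] at hz; exact lt_irrefl _ hz.2
    have h1 := abs_lt.1 hz.1
    have h2 := abs_lt.1 hyx
    rcases hzy.lt_or_gt with h3 | h3
    · have := h z hzD y hy h3
      grind
    · have := h y hy z hzD h3
      grind
  · push Not at hex
    exact ⟨δ, hδ, fun z hz hzD => absurd (near_self.1 hz) (not_lt.2 (hex z hzD))⟩

lemma Separated.exists_Ioo_disjoint {D : Set R} {s : R} (hs : 0 < s) (h : Separated s D) {a b : R}
    (hab : a < b) : ∃ u v, a ≤ u ∧ u < v ∧ v ≤ b ∧ ∀ x ∈ Ioo u v, x ∉ D := by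
  obtain ⟨c, hac, hc⟩ := exists_between (lt_min hab (lt_add_of_pos_right a hs))
  rw [lt_min_iff] at hc
  by_cases hex : ∃ y ∈ D, y ∈ Ioo a c
  · obtain ⟨y, hy, hya, hyc⟩ := hex
    refine ⟨a, y, le_rfl, hya, (hyc.trans hc.1).le, fun x hx hxD => ?_⟩
    have := h x hxD y hy hx.2
    have := hx.1
    grind
  · push Not at hex
    exact ⟨a, c, le_rfl, hac, hc.1.le, fun x hx hxD => hex x hxD hx⟩

lemma Separated.interior_eq {D : Set R} {s : R} (hs : 0 < s) (h : Separated s D) :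
    interior D = ∅ := by
  rw [interior_eq_empty_iff_Ioo]
  intro a b hab hsub
  obtain ⟨u, v, hau, huv, hvb, hd⟩ := h.exists_Ioo_disjoint hs hab
  obtain ⟨x, hx⟩ := exists_between huv
  exact hd x hx (hsub ⟨hau.trans_lt hx.1, hx.2.trans_le hvb⟩)

variable [DiscreteOrInterval L R]

/-- The chain lemma is used twice. For fixed `s` it separates the union over `r` uniformly, so this
union is closed without interior, and pseudo-finite once cut to `[p, q]`. These unions then form a
chain in `-s`, increasing as required, to which the lemma applies again. -/
lemma SigmaFam.exists_separated {F : Set (R × R × R)} (hF : SigmaFam L F)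
    (hint : ∀ r s, 0 < s → interior (slice F r s) = ∅) (p q : R) :
    ∃ s, 0 < s ∧ Separated s (total F ∩ Icc p q) := by
  have hFd := hF.defSet
  have hA : ∀ s, 0 < s → ∃ δ, 0 < δ ∧ Separated δ {x | ∃ r, (x, r, s) ∈ F} := by
    intro s hs
    have hd : DefPred L R fun p : R × R => (p.1, p.2, s) ∈ F := by fun_prop (disch := assumption)
    obtain ⟨δ, hδ, h⟩ := exists_separated_of_chain (L := L) (J := univ) (DefPred.const True)
      hd.defSet (fun r _ r' _ hr x hx => hF.mono hr hs le_rfl hx) fun r _ =>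
        ⟨hFd.slice r s, hF.isClosed r s hs, hF.isBdd r s hs, hint r s hs⟩
    refine ⟨δ, hδ, ?_⟩
    rintro x ⟨r, hx⟩ y ⟨r', hy⟩ hxy
    exact h (max r r') trivial x (hF.mono (le_max_left _ _) hs le_rfl hx) y
      (hF.mono (le_max_right _ _) hs le_rfl hy) hxy
  have hd : DefPred L R fun w : R × R => (∃ r : R, (w.1, r, - w.2) ∈ F) ∧ p ≤ w.1 ∧ w.1 ≤ q := by
    fun_prop (disch := assumption)
  have hJ : DefPred L R fun r : R => r < 0 := by fun_prop
  obtain ⟨δ, hδ, h⟩ := exists_separated_of_chain (L := L) (J := Iio 0) hJ.defSet hd.defSet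
    (by
      rintro t ht t' ht' htt x ⟨⟨r, hx⟩, hpq⟩
      exact ⟨⟨r, hF.mono le_rfl (neg_pos.2 ht') (neg_le_neg htt) hx⟩, hpq⟩)
    (by
      intro t ht
      obtain ⟨δ, hδ, hsep⟩ := hA (-t) (neg_pos.2 ht)
      have hsep' : Separated δ {x | (x, t) ∈ {w : R × R | (∃ r : R, (w.1, r, - w.2) ∈ F) ∧
        p ≤ w.1 ∧ w.1 ≤ q}} := hsep.subset fun x hx => hx.1
      refine ⟨?_, hsep'.isClosed hδ, isBdd_of_Icc (a := p) (b := q) fun x hx => hx.2,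
        hsep'.interior_eq hδ⟩
      have : DefPred L R fun x : R => (∃ r : R, (x, r, - t) ∈ F) ∧ p ≤ x ∧ x ≤ q := by
        fun_prop (disch := assumption)
      exact this)
  refine ⟨δ, hδ, ?_⟩
  rintro x ⟨⟨r, s, hs, hx⟩, hxpq⟩ y ⟨⟨r', s', hs', hy⟩, hypq⟩ hxy
  refine h (- min s s') (neg_neg_of_pos (lt_min hs hs')) x ⟨⟨r, ?_⟩, hxpq⟩ y ⟨⟨r', ?_⟩, hypq⟩ hxy
  · rw [neg_neg]; exact hF.mono le_rfl (lt_min hs hs') (min_le_left _ _) hx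
  · rw [neg_neg]; exact hF.mono le_rfl (lt_min hs hs') (min_le_right _ _) hy

lemma SigmaFam.exists_Ioo_disjoint {F : Set (R × R × R)} (hF : SigmaFam L F)
    (hint : ∀ r s, 0 < s → interior (slice F r s) = ∅) {p q : R} (hpq : p < q) :
    ∃ u v, p ≤ u ∧ u < v ∧ v ≤ q ∧ ∀ x ∈ Ioo u v, x ∉ total F := by
  obtain ⟨s, hs, h⟩ := hF.exists_separated hint p q
  obtain ⟨u, v, hpu, huv, hvq, hd⟩ := h.exists_Ioo_disjoint hs hpq
  exact ⟨u, v, hpu, huv, hvq, fun x hx hxF =>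
    hd x hx ⟨hxF, hpu.trans hx.1.le, hx.2.le.trans hvq⟩⟩

instance definablyBaire_self : DefinablyBaire L R R where
  exists_open F hF hint U hU hne := by
    obtain ⟨x, hx⟩ := hne
    obtain ⟨l, u, hlu, hsub⟩ := mem_nhds_iff_exists_Ioo_subset.1 (hU.mem_nhds hx)
    obtain ⟨a, b, ha, hab, hb, h⟩ := hF.exists_Ioo_disjoint hint (hlu.1.trans hlu.2)
    exact ⟨Ioo a b, (Ioo_subset_Ioo ha hb).trans hsub, isOpen_Ioo, nonempty_Ioo.2 hab, h⟩

end SigmaFamilies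

/-! ### The Baire property for products -/

section Products

variable {L : Language} {R : Type u} [TopologicalSpace R] [L.Structure R] [AddCommGroup R]
  [LinearOrder R] [IsOrderedAddMonoid R] [DefinablyCompleteGroup L R]
  [DenselyOrdered R] [Nontrivial R] [OrderTopology R]
variable {X Y Z : Type*} [TopologicalSpace X] [TopologicalSpace Y] [TopologicalSpace Z]
variable [CoordSpace R X] [CoordSpace R Y] [CoordSpace R Z]

lemma IsBdd.exists_abs_snd_le {C : Set (X × R)} (h : IsBdd R C) : ∃ M, ∀ p ∈ C, |p.2| ≤ M :=
  h.imp fun _ hM p hp => bddBy_self.1 (bddBy_prod.1 (hM p hp)).2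

/-- The parameter `s` serves both as index of the slice and as segment length. Decreasing it
enlarges the slice and shortens the segment, so monotonicity survives, and the total detects fibre
intervals of any length. -/
lemma SigmaFam.segmentBase {F : Set ((X × R) × R × R)} (hF : SigmaFam L F) :
    SigmaFam L {p : X × R × R | p.1 ∈ segmentBase (slice F p.2.1 p.2.2) p.2.2} := by
  have hFd := hF.defSet
  refine ⟨?_, fun r s hs => ?_, fun r s hs => ?_, ?_⟩
  · have : DefPred L R fun p : X × R × R => ∃ a : R, ∀ y : R, a ≤ y → y ≤ a + p.2.2 →
        ((p.1, y), p.2.1, p.2.2) ∈ F := by fun_prop (disch := assumption)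
    exact this
  · obtain ⟨M, hM⟩ := (hF.isBdd r s hs).exists_abs_snd_le
    exact isClosed_segmentBase (hF.defSet.slice r s) (hF.isClosed r s hs) hM hs
  · obtain ⟨M, hM⟩ := hF.isBdd r s hs
    refine ⟨M, ?_⟩
    rintro x ⟨a, ha⟩
    exact (bddBy_prod.1 (hM _ (ha a le_rfl (by simpa using hs.le)))).1
  · rintro r r' s s' hr hs' hs x ⟨a, ha⟩
    refine ⟨a, fun y h1 h2 => hF.mono hr hs' hs (ha y h1 (h2.trans ?_))⟩
    simpa using hs

/-- If a family has no interior then generically neither do its fibres. -/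
lemma SigmaFam.exists_open_interior_fibre_eq [DefinablyBaire L R X] {F : Set ((X × R) × R × R)}
    (hF : SigmaFam L F) (hint : ∀ r s, 0 < s → interior (slice F r s) = ∅) {U : Set X}
    (hU : IsOpen U) (hne : U.Nonempty) :
    ∃ V ⊆ U, IsOpen V ∧ V.Nonempty ∧ ∀ x ∈ V, ∀ r s, 0 < s →
      interior {y | ((x, y), r, s) ∈ F} = ∅ := by
  obtain ⟨V, hVU, hVo, hVne, hV⟩ := DefinablyBaire.exists_open _ hF.segmentBase
    (fun r s hs => by
      obtain ⟨M, hM⟩ := (hF.isBdd r s hs).exists_abs_snd_le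
      exact interior_segmentBase (hF.defSet.slice r s) (hF.isClosed r s hs) hM (hint r s hs) hs)
    U hU hne
  refine ⟨V, hVU, hVo, hVne, fun x hx r s hs => ?_⟩
  rw [interior_eq_empty_iff_Ioo]
  intro a b hab hsub
  obtain ⟨a', ha', hb'⟩ := exists_between hab
  obtain ⟨t, ht, htb⟩ := exists_between (lt_min (sub_pos.2 hb') hs)
  rw [lt_min_iff] at htb
  refine hV x hx ⟨r, t, ht, a', fun y h1 h2 => ?_⟩
  have hy : y ∈ Ioo a b := ⟨ha'.trans_le h1, by have := htb.1; grind⟩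
  exact hF.mono le_rfl ht htb.2.le (hsub hy)

/-- A definable closed bounded set without interior has, over a smaller open set, uniformly
separated fibres. -/
lemma exists_open_separated_fibres [DiscreteOrInterval L R] [DefinablyBaire L R X]
    {T : Set (X × R)} (hd : DefSet L R T)
    (hc : IsClosed T) (hb : IsBdd R T) (hint : interior T = ∅) {U : Set X} (hU : IsOpen U)
    (hne : U.Nonempty) :
    ∃ V ⊆ U, IsOpen V ∧ V.Nonempty ∧ ∃ s : R, 0 < s ∧ ∀ x ∈ V, Separated s {y | (x, y) ∈ T} := by
  have hFd : DefPred L R fun p : (X × R) × R × R => p.1 ∈ T := by fun_prop (disch := assumption)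
  have hF : SigmaFam L {p : (X × R) × R × R | p.1 ∈ T} :=
    ⟨hFd, fun _ _ _ => hc, fun _ _ _ => hb, fun _ _ _ => Subset.rfl⟩
  obtain ⟨V, hVU, hVo, ⟨x₀, hx₀⟩, hV⟩ := hF.exists_open_interior_fibre_eq (fun _ _ _ => hint) hU hne
  obtain ⟨M, hM⟩ := hb
  have hsep : ∀ x ∈ V, ∃ s : R, 0 < s ∧ Separated s {y | (x, y) ∈ T} := by
    intro x hx
    have h0 := hV x hx 0
    obtain ⟨s, hs⟩ := exists_gt (0 : R)
    exact PseudoFinite.exists_separated (L := L) ⟨hd.fibre x, hc.preimage (by fun_prop),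
      ⟨M, fun y hy => (bddBy_prod.1 (hM _ hy)).2⟩, h0 s hs⟩
  obtain ⟨ε, hε, hbox⟩ := exists_closedNear_subset (R := R) hVo hx₀
  have hNd : DefPred L R fun p : X × R => ∃ y z : R, (p.1, y) ∈ T ∧ (p.1, z) ∈ T ∧ y < z ∧
      z - y < p.2 := by fun_prop (disch := assumption)
  -- `N` records the failure of separation at scale `s`. Every point of the box leaves it for small
  -- `s`, but the sets of points outside `N` need not be closed, so the complements of the interiors
  -- are used for the Baire argument.
  set N : Set (X × R) := {p : X × R | ∃ y z : R, (p.1, y) ∈ T ∧ (p.1, z) ∈ T ∧ y < z ∧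
      z - y < p.2} with hN
  have hMd : DefPred L R fun p : X × R => ClosedNear ε x₀ p.1 ∧ ¬ ∃ δ : R, 0 < δ ∧
      ∀ x, Near δ p.1 x → (x, p.2) ∈ N := by
    have : DefSet L R N := hNd
    fun_prop (disch := assumption)
  have hNi : ∀ x s, (∃ δ : R, 0 < δ ∧ ∀ x', Near δ x x' → (x', s) ∈ N) ↔
      x ∈ interior {x | (x, s) ∈ N} := fun x s => mem_interior_iff_near.symm
  simp only [hNi] at hMd
  have hMc : ∀ s, IsClosed {x | ClosedNear ε x₀ x ∧ x ∉ interior {x | (x, s) ∈ N}} := fun s =>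
    (isClosed_closedNear ε x₀).inter isOpen_interior.isClosed_compl
  have hNm : ∀ {s s' : R}, s' ≤ s → interior {x | (x, s') ∈ N} ⊆ interior {x | (x, s) ∈ N} := by
    refine fun hss => interior_mono ?_
    rintro x ⟨y, z, h1, h2, h3, h4⟩
    exact ⟨y, z, h1, h2, h3, h4.trans_le hss⟩
  obtain ⟨s, hs, hW⟩ := DefinablyBaire.exists_interior_nonempty_of_antitone hMd.defSet
    (fun s _ => hMc s)
    (fun s hs => (isBdd_closedNear ε x₀).subset fun x hx => hx.1)
    (fun s s' _ hss x hx => ⟨hx.1, fun h => hx.2 (hNm hss h)⟩)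
    (isOpen_near ε x₀) ⟨x₀, near_refl hε x₀⟩
    (fun x hx => by
      obtain ⟨s, hs, h⟩ := hsep x (hbox x (Near.closedNear hx))
      refine ⟨s, hs, Near.closedNear hx, fun hi => ?_⟩
      obtain ⟨y, z, hy, hz, hyz, hlt⟩ := interior_subset hi
      exact absurd (h y hy z hz hyz) (not_le.2 hlt))
  set W := interior {x | (x, s) ∈ {p : X × R | ClosedNear ε x₀ p.1 ∧
    p.1 ∉ interior {x | (x, p.2) ∈ N}}} with hWdef
  -- For the fixed `s`, the strict conditions `0 < z - y < s` are exhausted by the closed ones `t ≤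
  -- z - y ≤ s - t`, which exhibits the slice of `N` at `s` as a Σ set.
  have hGd : DefPred L R fun p : X × R × R => ∃ w : R × R, (p.1, w.1) ∈ T ∧ (p.1, w.2) ∈ T ∧
      w.1 + p.2.2 ≤ w.2 ∧ w.2 + p.2.2 ≤ w.1 + s := by fun_prop (disch := assumption)
  have hG : SigmaFam L {p : X × R × R | ∃ w : R × R, (p.1, w.1) ∈ T ∧ (p.1, w.2) ∈ T ∧
      w.1 + p.2.2 ≤ w.2 ∧ w.2 + p.2.2 ≤ w.1 + s} := by
    refine ⟨hGd, fun r t ht => ?_, fun r t ht => ⟨M, ?_⟩, ?_⟩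
    · have hd' : DefPred L R fun q : X × R × R => (q.1, q.2.1) ∈ T ∧ (q.1, q.2.2) ∈ T ∧
        q.2.1 + t ≤ q.2.2 ∧ q.2.2 + t ≤ q.2.1 + s := by fun_prop (disch := assumption)
      refine isClosed_exists hd'.defSet ?_ ⟨M, fun q hq => bddBy_prod.2 ⟨?_, ?_⟩⟩
      · exact (hc.preimage (by fun_prop)).inter ((hc.preimage (by fun_prop)).inter
          ((isClosed_le (by fun_prop) (by fun_prop)).inter
            (isClosed_le (by fun_prop) (by fun_prop))))
      · exact (bddBy_prod.1 (hM _ hq.1)).2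
      · exact (bddBy_prod.1 (hM _ hq.2.1)).2
    · rintro x ⟨w, hw, -⟩
      exact (bddBy_prod.1 (hM _ hw)).1
    · rintro r r' t t' - - ht x ⟨w, h1, h2, h3, h4⟩
      exact ⟨w, h1, h2, by simp only at *; grind, by simp only at *; grind⟩
  have htot : ∀ x, x ∈ total {p : X × R × R | ∃ w : R × R, (p.1, w.1) ∈ T ∧ (p.1, w.2) ∈ T ∧
      w.1 + p.2.2 ≤ w.2 ∧ w.2 + p.2.2 ≤ w.1 + s} ↔ (x, s) ∈ N := by
    intro x
    constructor
    · rintro ⟨r, t, ht, w, h1, h2, h3, h4⟩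
      exact ⟨w.1, w.2, h1, h2, by simp only at *; grind, by simp only at *; grind⟩
    · rintro ⟨y, z, h1, h2, h3, h4⟩
      refine ⟨0, min (z - y) (s - (z - y)), lt_min (sub_pos.2 h3) (sub_pos.2 h4), (y, z), h1, h2,
        ?_, ?_⟩
      · have := min_le_left (z - y) (s - (z - y)); simp only at *; grind
      · have := min_le_right (z - y) (s - (z - y)); simp only at *; grind
  have hWN : ∀ O ⊆ W, IsOpen O → O.Nonempty → ¬ ∀ x ∈ O, (x, s) ∈ N := by
    rintro O hO hOo ⟨x, hx⟩ h
    exact (interior_subset (hO hx)).2 (interior_maximal h hOo hx)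
  -- Without uniform separation on any open set, the slice of `N` at `s` would be dense in `W`.
  -- Being Σ it would contain an open subset of `W`, yet `W` avoids its interior.
  by_contra! hcon
  obtain ⟨O, hOW, hOo, -, hOne, hO⟩ := DefinablyBaire.exists_open_subset hG
    (isOpen_interior : IsOpen W) hW (fun V hVW hVo hVne => by
      by_contra! hno
      obtain ⟨x, hx, hsepx⟩ := hcon V (fun x hx => hVU (hbox x (interior_subset (hVW hx)).1))
        hVo hVne s hs
      refine hno x hx ((htot x).2 ?_)
      simp only [Separated, not_forall, not_le] at hsepx
      obtain ⟨y, hy, z, hz, hyz, hlt⟩ := hsepx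
      exact ⟨y, z, hy, hz, hyz, hlt⟩)
  exact hWN O hOW hOo hOne fun x hx => (htot x).1 (hO hx)

/-- Kuratowski–Ulam: if the union were dense in a box, its fibres would generically still be unions
without interior in each slice, so each would miss a segment. The Baire property of `X` makes the
length and position of the segment nearly constant over an open set, and there density in a thin
slab is contradicted. -/
instance definablyBaire_prod [DiscreteOrInterval L R] [DefinablyBaire L R X] :
    DefinablyBaire L R (X × R) where
  exists_open F hF hint U₀ hU₀ hne₀ := by
    have hFd := hF.defSet
    by_contra! hcon
    obtain ⟨⟨x₁, y₁⟩, h₁⟩ := hne₀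
    obtain ⟨ε₁, hε₁, hbox₁⟩ := mem_nhds_iff_near (R := R).1 (hU₀.mem_nhds h₁)
    set p := y₁ - ε₁ with hp
    set q := y₁ + ε₁ with hq
    have hpq : p < q := by grind
    have hUsub : {x | Near ε₁ x₁ x} ×ˢ Ioo p q ⊆ U₀ := by
      rintro ⟨x, y⟩ ⟨hx, hy⟩
      refine hbox₁ _ (near_prod.2 ⟨hx, near_self.2 (abs_lt.2 ?_)⟩)
      have := hy.1
      have := hy.2
      simp only at *
      constructor <;> grind
    have hdense : ∀ V : Set X, (∀ x ∈ V, Near ε₁ x₁ x) → IsOpen V → V.Nonempty → ∀ u v, p ≤ u →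
        u < v → v ≤ q → ∃ x ∈ V, ∃ y, u < y ∧ y < v ∧ (x, y) ∈ total F := by
      rintro V hV hVo hVne u v hpu huv hvq
      obtain ⟨⟨x, y⟩, hxy, h⟩ := hcon (V ×ˢ Ioo u v) ((prod_mono hV (Ioo_subset_Ioo hpu hvq)).trans
        hUsub) (hVo.prod isOpen_Ioo) (hVne.prod (nonempty_Ioo.2 huv))
      exact ⟨x, hxy.1, y, hxy.2.1, hxy.2.2, h⟩
    obtain ⟨V, hVU, hVo, ⟨x₀, hx₀⟩, hV⟩ := hF.exists_open_interior_fibre_eq hint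
      (isOpen_near ε₁ x₁) ⟨x₁, near_refl hε₁ x₁⟩
    obtain ⟨ε, hε, hbox⟩ := exists_closedNear_subset (R := R) hVo hx₀
    have hgap : ∀ x ∈ V, ∃ a t : R, 0 < t ∧ p ≤ a ∧ a + t ≤ q ∧
        ∀ y, a ≤ y → y ≤ a + t → (x, y) ∉ total F := by
      intro x hx
      obtain ⟨u, v, hpu, huv, hvq, h⟩ := (hF.fibre x).exists_Ioo_disjoint (hV x hx) hpq
      obtain ⟨a, hua, hav⟩ := exists_between huv
      obtain ⟨b, hab, hbv⟩ := exists_between hav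
      exact ⟨a, b - a, sub_pos.2 hab, hpu.trans hua.le, by simpa using hbv.le.trans hvq,
        fun y h1 h2 => h y ⟨hua.trans_le h1, (by simpa using h2 : y ≤ b).trans_lt hbv⟩⟩
    have hAd := hFd.total
    have hZd : DefPred L R fun w : (X × R) × R => ∃ y : R, w.1.2 ≤ y ∧ y ≤ w.1.2 + w.2 ∧
        (w.1.1, y) ∈ total F := by fun_prop (disch := assumption)
    -- `(x, a)` lies in `Z t` when the segment `[a, a + t]` over `x` meets the union. Being outside
    -- `Z t` is not a closed condition, so it is weakened to being outside its interior, which is.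
    set Z : R → Set (X × R) := fun t =>
      {w | ∃ y : R, w.2 ≤ y ∧ y ≤ w.2 + t ∧ (w.1, y) ∈ total F} with hZ
    have hCd : DefPred L R fun w : (X × R) × R => (ClosedNear ε x₀ w.1.1 ∧ p ≤ w.1.2 ∧
        w.1.2 + w.2 ≤ q) ∧ ¬ ∃ δ : R, 0 < δ ∧ ∀ v, Near δ w.1 v → (v, w.2) ∈
        {w : (X × R) × R | ∃ y : R, w.1.2 ≤ y ∧ y ≤ w.1.2 + w.2 ∧ (w.1.1, y) ∈ total F} := by
      have := hZd.defSet
      fun_prop (disch := assumption)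
    have hZi : ∀ (w : X × R) (t : R), (∃ δ : R, 0 < δ ∧ ∀ v, Near δ w v → (v, t) ∈
        {w : (X × R) × R | ∃ y : R, w.1.2 ≤ y ∧ y ≤ w.1.2 + w.2 ∧ (w.1.1, y) ∈ total F}) ↔
        w ∈ interior (Z t) := fun w t => mem_interior_iff_near.symm
    simp only [hZi] at hCd
    have hZm : ∀ {t t' : R}, t' ≤ t → interior (Z t') ⊆ interior (Z t) := by
      refine fun htt => interior_mono ?_
      rintro w ⟨y, h1, h2, h3⟩
      exact ⟨y, h1, h2.trans (by simpa using htt), h3⟩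
    have hCtd : ∀ t : R, DefPred L R fun w : X × R => (ClosedNear ε x₀ w.1 ∧ p ≤ w.2 ∧
        w.2 + t ≤ q) ∧ w ∉ interior (Z t) := by
      intro t
      have := hCd.defSet
      have h2 : DefPred L R fun w : X × R => (w, t) ∈ {w : (X × R) × R | (ClosedNear ε x₀ w.1.1 ∧
        p ≤ w.1.2 ∧ w.1.2 + w.2 ≤ q) ∧ w.1 ∉ interior (Z w.2)} := by
        fun_prop (disch := assumption)
      exact h2
    have hCc : ∀ t : R, IsClosed {w : X × R | (ClosedNear ε x₀ w.1 ∧ p ≤ w.2 ∧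
        w.2 + t ≤ q) ∧ w ∉ interior (Z t)} := fun t =>
      (((isClosed_closedNear ε x₀).preimage continuous_fst).inter
        ((isClosed_le (by fun_prop) (by fun_prop)).inter
          (isClosed_le (by fun_prop) (by fun_prop)))).inter isOpen_interior.isClosed_compl
    have hCb : ∀ t : R, 0 < t → ∀ w ∈ {w : X × R | (ClosedNear ε x₀ w.1 ∧ p ≤ w.2 ∧
        w.2 + t ≤ q) ∧ w ∉ interior (Z t)}, |w.2| ≤ max |p| |q| := by
      rintro t ht w ⟨⟨-, h1, h2⟩, -⟩
      exact abs_le_max_abs_abs h1 ((le_add_of_nonneg_right ht.le).trans h2)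
    have hKd : DefPred L R fun v : X × R => ∃ a : R, ((v.1, a), v.2) ∈
        {w : (X × R) × R | (ClosedNear ε x₀ w.1.1 ∧
        p ≤ w.1.2 ∧ w.1.2 + w.2 ≤ q) ∧ w.1 ∉ interior (Z w.2)} := by
      have := hCd.defSet
      fun_prop (disch := assumption)
    obtain ⟨t, ht, hW⟩ := DefinablyBaire.exists_interior_nonempty_of_antitone hKd.defSet
      (fun t ht => isClosed_exists_of_bounded_line (hCtd t).defSet (hCc t) (hCb t ht))
      (fun t ht => (isBdd_closedNear ε x₀).subset fun x ⟨a, ha⟩ => ha.1.1)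
      (fun t t' _ htt x ⟨a, ha⟩ => ⟨a, ⟨ha.1.1, ha.1.2.1, le_trans (by simpa using htt) ha.1.2.2⟩,
        fun h => ha.2 (hZm htt h)⟩)
      (isOpen_near ε x₀) ⟨x₀, near_refl hε x₀⟩
      (fun x hx => by
        obtain ⟨a, t, ht, hpa, hatq, h⟩ := hgap x (hbox x (Near.closedNear hx))
        refine ⟨t, ht, a, ⟨Near.closedNear hx, hpa, hatq⟩, fun hi => ?_⟩
        obtain ⟨y, h1, h2, h3⟩ := interior_subset hi
        exact h y h1 h2 h3)
    -- With `4h < t`, every segment of length `t` starting in `(c - h, c + h)` contains the slab `[c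
    -- + h, c + 2h]`.
    obtain ⟨h, hh, hht⟩ := exists_add_add_add_lt ht
    obtain ⟨c, W, hWsub, hWo, hWd, ⟨x₂, hx₂⟩, hWc⟩ := exists_open_fibre_near (hCtd t).defSet (hCc t)
      (hCb t ht) isOpen_interior (DefSet.fibre (X := R) (S := {v : R × X | ∃ a : R, ((v.2, a), v.1) ∈
        {w : (X × R) × R | (ClosedNear ε x₀ w.1.1 ∧
        p ≤ w.1.2 ∧ w.1.2 + w.2 ≤ q) ∧ w.1 ∉ interior (Z w.2)}} ) (by
          have := hCd.defSet
          have h3 : DefPred L R fun v : R × X => ∃ a : R, ((v.2, a), v.1) ∈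
            {w : (X × R) × R | (ClosedNear ε x₀ w.1.1 ∧
            p ≤ w.1.2 ∧ w.1.2 + w.2 ≤ q) ∧ w.1 ∉ interior (Z w.2)} := by
            fun_prop (disch := assumption)
          exact h3) t).interior hW (fun x hx => by
            obtain ⟨a, ha⟩ := interior_subset hx
            exact ⟨a, ha⟩) hh
    have hWV : W ⊆ V := fun x hx => by
      obtain ⟨a, ha⟩ := interior_subset (hWsub hx)
      exact hbox x ha.1.1
    have hcpq : p ≤ c + h ∧ c + h + h ≤ q := by
      obtain ⟨a, ⟨⟨-, h1, h2⟩, -⟩, h3, h4⟩ := hWc x₂ hx₂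
      simp only at h1 h2
      constructor <;> grind
    have hGd : DefPred L R fun v : X × R × R => ∃ y : R, c + h ≤ y ∧ y ≤ c + h + h ∧
        ((v.1, y), v.2.1, v.2.2) ∈ F := by fun_prop (disch := assumption)
    have hG : SigmaFam L {v : X × R × R | ∃ y : R, c + h ≤ y ∧ y ≤ c + h + h ∧
        ((v.1, y), v.2.1, v.2.2) ∈ F} := by
      refine ⟨hGd, fun r s hs => ?_, fun r s hs => ?_, ?_⟩
      · have hd' : DefPred L R fun w : X × R => c + h ≤ w.2 ∧ w.2 ≤ c + h + h ∧ (w, r, s) ∈ F := by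
          fun_prop (disch := assumption)
        obtain ⟨M, hM⟩ := (hF.isBdd r s hs).exists_abs_snd_le
        exact isClosed_exists_of_bounded_line hd'.defSet
          ((isClosed_le (by fun_prop) (by fun_prop)).inter
            ((isClosed_le (by fun_prop) (by fun_prop)).inter (hF.isClosed r s hs))) (M := M)
          fun w hw => hM _ hw.2.2
      · obtain ⟨M, hM⟩ := hF.isBdd r s hs
        refine ⟨M, ?_⟩
        rintro x ⟨y, -, -, hy⟩
        exact (bddBy_prod.1 (hM _ hy)).1
      · rintro r r' s s' hr hs' hs x ⟨y, h1, h2, h3⟩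
        exact ⟨y, h1, h2, hF.mono hr hs' hs h3⟩
    -- The part of the union in the slab projects to a Σ set dense in `W`, hence covering some open
    -- `O`. Then `O ×ˢ Ioo (c - h) (c + h)` lies in `Z t`, although it contains a point `(x₃, a)`
    -- outside the interior.
    obtain ⟨O, hOW, hOo, -, ⟨x₃, hx₃⟩, hO⟩ := DefinablyBaire.exists_open_subset hG hWo ⟨x₂, hx₂⟩
      (fun V' hV' hVo' hVne' => by
        obtain ⟨x, hx, y, h1, h2, r, s, hs, h3⟩ := hdense V' (fun x hx => hVU (hWV (hV' hx))) hVo'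
          hVne' (c + h) (c + h + h) hcpq.1 (lt_add_of_pos_right _ hh) hcpq.2
        exact ⟨x, hx, r, s, hs, y, h1.le, h2.le, h3⟩)
    obtain ⟨a, ha, hca, hac⟩ := hWc x₃ (hOW hx₃)
    refine ha.2 (interior_maximal (t := O ×ˢ Ioo (c - h) (c + h)) ?_ (hOo.prod isOpen_Ioo)
      ⟨hx₃, hca, hac.trans_lt (lt_add_of_pos_right _ hh)⟩)
    rintro ⟨x, b⟩ ⟨hx, hb1, hb2⟩
    obtain ⟨r, s, hs, y, h1, h2, h3⟩ := hO hx
    exact ⟨y, hb2.le.trans h1, by simp only at *; grind, r, s, hs, h3⟩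

end Products

/-! ### Closure properties of Σ sets and the dimension drop at the boundary -/

section SigmaSets

variable {L : Language} {R : Type u} [TopologicalSpace R] [L.Structure R] [AddCommGroup R]
  [LinearOrder R] [IsOrderedAddMonoid R] [DefinablyCompleteGroup L R]
  [DenselyOrdered R] [Nontrivial R] [OrderTopology R]
variable {X Y Z : Type*} [TopologicalSpace X] [TopologicalSpace Y] [TopologicalSpace Z]
variable [CoordSpace R X] [CoordSpace R Y] [CoordSpace R Z]

variable (L R) in
/-- Unions of definable two-parameter families of closed bounded sets. -/
def IsSigma (A : Set X) : Prop := ∃ F : Set (X × R × R), SigmaFam L F ∧ total F = A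

lemma IsSigma.defSet {A : Set X} (hA : IsSigma L R A) : DefSet L R A := by
  obtain ⟨F, hF, rfl⟩ := hA
  exact hF.defSet.total

lemma SigmaFam.of_closed {C : Set X} (hC : DefSet L R C) (hCc : IsClosed C) :
    SigmaFam L {p : X × R × R | p.1 ∈ C ∧ BddBy p.2.1 p.1} := by
  have : DefPred L R fun p : X × R × R => p.1 ∈ C ∧ BddBy p.2.1 p.1 := by
    fun_prop (disch := assumption)
  exact ⟨this, fun r s _ => hCc.inter (isClosed_bddBy r), fun r s _ => ⟨r, fun x hx => hx.2⟩,
    fun hr _ _ x hx => ⟨hx.1, hx.2.mono hr⟩⟩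

lemma IsSigma.of_closed {C : Set X} (hC : DefSet L R C) (hCc : IsClosed C) : IsSigma L R C := by
  refine ⟨_, SigmaFam.of_closed hC hCc, ?_⟩
  ext x
  constructor
  · rintro ⟨r, s, -, h, -⟩
    exact h
  · intro hx
    obtain ⟨M, hM⟩ := exists_bddBy (R := R) x
    obtain ⟨s, hs⟩ := exists_gt (0 : R)
    exact ⟨M, s, hs, hx, hM⟩

lemma isClosed_box_subset {U : Set X} (s : R) : IsClosed {x | ∀ y, Near s x y → y ∈ U} := by
  rw [← isOpen_compl_iff, isOpen_iff_mem_nhds]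
  intro x hx
  simp only [mem_compl_iff, mem_ofPred_eq, not_forall] at hx
  obtain ⟨y, hy, hyU⟩ := hx
  have : {x' : X | Near s y x'} ∈ 𝓝 x :=
    (isOpen_near s y).mem_nhds fun i => by rw [abs_sub_comm]; exact hy i
  filter_upwards [this] with x' hx' h
  exact hyU (h y fun i => by rw [abs_sub_comm]; exact hx' i)

/-- The two parameters have separate roles: `r` bounds the coordinates, while `s` is a margin,
keeping only points whose `s`-box stays in `U`. The margin condition is closed. -/
lemma IsSigma.of_open {U : Set X} (hU : DefSet L R U) (hUo : IsOpen U) : IsSigma L R U := by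
  have : DefPred L R fun p : X × R × R => (∀ y, Near p.2.2 p.1 y → y ∈ U) ∧ BddBy p.2.1 p.1 := by
    fun_prop (disch := assumption)
  refine ⟨{p : X × R × R | (∀ y, Near p.2.2 p.1 y → y ∈ U) ∧ BddBy p.2.1 p.1},
    ⟨this, fun r s _ => (isClosed_box_subset s).inter (isClosed_bddBy r),
      fun r s _ => ⟨r, fun x hx => hx.2⟩,
      fun hr _ hs x hx => ⟨fun y hy => hx.1 y (hy.mono hs), hx.2.mono hr⟩⟩, ?_⟩
  ext x
  constructor
  · rintro ⟨r, s, hs, h, -⟩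
    exact h x (near_refl hs x)
  · intro hx
    obtain ⟨M, hM⟩ := exists_bddBy (R := R) x
    obtain ⟨ε, hε, h⟩ := mem_nhds_iff_near (R := R).1 (hUo.mem_nhds hx)
    exact ⟨M, ε, hε, h, hM⟩

lemma IsBdd.union {S T : Set X} (hS : IsBdd R S) (hT : IsBdd R T) : IsBdd R (S ∪ T) := by
  obtain ⟨M, hM⟩ := hS
  obtain ⟨N, hN⟩ := hT
  exact ⟨max M N, fun x hx => hx.elim (fun h => (hM x h).mono (le_max_left _ _))
    fun h => (hN x h).mono (le_max_right _ _)⟩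

lemma IsSigma.union {A B : Set X} (hA : IsSigma L R A) (hB : IsSigma L R B) :
    IsSigma L R (A ∪ B) := by
  obtain ⟨F, hF, rfl⟩ := hA
  obtain ⟨G, hG, rfl⟩ := hB
  refine ⟨F ∪ G, ⟨hF.defSet.union hG.defSet,
    fun r s hs => (hF.isClosed r s hs).union (hG.isClosed r s hs),
    fun r s hs => (hF.isBdd r s hs).union (hG.isBdd r s hs),
    fun hr hs' hs x hx => hx.imp (fun h => hF.mono hr hs' hs h)
      fun h => hG.mono hr hs' hs h⟩, ?_⟩
  ext x
  constructor
  · rintro ⟨r, s, hs, h | h⟩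
    exacts [Or.inl ⟨r, s, hs, h⟩, Or.inr ⟨r, s, hs, h⟩]
  · rintro (⟨r, s, hs, h⟩ | ⟨r, s, hs, h⟩)
    exacts [⟨r, s, hs, Or.inl h⟩, ⟨r, s, hs, Or.inr h⟩]

lemma IsSigma.inter {A B : Set X} (hA : IsSigma L R A) (hB : IsSigma L R B) :
    IsSigma L R (A ∩ B) := by
  obtain ⟨F, hF, rfl⟩ := hA
  obtain ⟨G, hG, rfl⟩ := hB
  refine ⟨F ∩ G, ⟨hF.defSet.inter hG.defSet,
    fun r s hs => (hF.isClosed r s hs).inter (hG.isClosed r s hs),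
    fun r s hs => (hF.isBdd r s hs).subset inter_subset_left,
    fun hr hs' hs x hx => ⟨hF.mono hr hs' hs hx.1, hG.mono hr hs' hs hx.2⟩⟩, ?_⟩
  ext x
  constructor
  · rintro ⟨r, s, hs, h1, h2⟩
    exact ⟨⟨r, s, hs, h1⟩, ⟨r, s, hs, h2⟩⟩
  · rintro ⟨⟨r, s, hs, h1⟩, ⟨r', s', hs', h2⟩⟩
    exact ⟨max r r', min s s', lt_min hs hs',
      hF.mono (le_max_left _ _) (lt_min hs hs') (min_le_left _ _) h1,
      hG.mono (le_max_right _ _) (lt_min hs hs') (min_le_right _ _) h2⟩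

/-- Continuous definable maps that do not increase coordinate bounds. -/
structure IsProjection (L : Language) (R : Type u) [TopologicalSpace R] [L.Structure R]
    [AddCommGroup R] [LinearOrder R] {X Z : Type*} [TopologicalSpace X] [TopologicalSpace Z]
    [CoordSpace R X] [CoordSpace R Z] (f : Z → X) : Prop where
  defMap : DefMap L R f
  continuous : Continuous f
  bddBy : ∀ (M : R) z, BddBy M z → BddBy M (f z)

lemma t2Space_of_coordSpace (R : Type u) [TopologicalSpace R] [T2Space R] (X : Type*)
    [TopologicalSpace X] [CoordSpace R X] : T2Space X :=
  (coord (R := R) (X := X)).isEmbedding.t2Space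

lemma SigmaFam.image {F : Set (Z × R × R)} (hF : SigmaFam L F) {f : Z → X}
    (hf : IsProjection L R f) :
    SigmaFam L {p : X × R × R | ∃ z, (z, p.2.1, p.2.2) ∈ F ∧ f z = p.1} := by
  have := t2Space_of_coordSpace R X
  have hFd := hF.defSet
  have hd : DefPred L R fun p : X × R × R => ∃ z, (z, p.2.1, p.2.2) ∈ F ∧ f z = p.1 := by
    have := hf.defMap
    fun_prop (disch := assumption)
  refine ⟨hd, fun r s hs => ?_, fun r s hs => ?_, ?_⟩
  · exact isClosed_image (hFd.slice r s) (hF.isClosed r s hs) (hF.isBdd r s hs) hf.defMap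
      hf.continuous
  · obtain ⟨M, hM⟩ := hF.isBdd r s hs
    refine ⟨M, ?_⟩
    rintro x ⟨z, hz, rfl⟩
    exact hf.bddBy M z (hM z hz)
  · rintro r r' s s' hr hs' hs x ⟨z, hz, rfl⟩
    exact ⟨z, hF.mono hr hs' hs hz, rfl⟩

lemma IsSigma.image {A : Set Z} (hA : IsSigma L R A) {f : Z → X} (hf : IsProjection L R f) :
    IsSigma L R (f '' A) := by
  obtain ⟨F, hF, rfl⟩ := hA
  refine ⟨_, hF.image hf, ?_⟩
  ext x
  constructor
  · rintro ⟨r, s, hs, z, hz, rfl⟩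
    exact ⟨z, ⟨r, s, hs, hz⟩, rfl⟩
  · rintro ⟨z, ⟨r, s, hs, hz⟩, rfl⟩
    exact ⟨r, s, hs, z, hz, rfl⟩

lemma IsSigma.exists_open_subset [DefinablyBaire L R X] {A : Set X} (hA : IsSigma L R A)
    {U : Set X} (hU : IsOpen U) (hne : U.Nonempty)
    (hd : ∀ V ⊆ U, IsOpen V → V.Nonempty → (V ∩ A).Nonempty) :
    ∃ V ⊆ U, IsOpen V ∧ V.Nonempty ∧ V ⊆ A := by
  obtain ⟨F, hF, rfl⟩ := hA
  obtain ⟨V, hVU, hVo, -, hVne, hV⟩ := DefinablyBaire.exists_open_subset hF hU hne hd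
  exact ⟨V, hVU, hVo, hVne, hV⟩

variable {ι : Type} [Finite ι]

lemma IsProjection.prodMk_apply {f : (ι → R) → X} (hf : IsProjection L R f) (i : ι) :
    IsProjection L R fun z => (f z, z i) :=
  ⟨hf.defMap.prodMk (DefMap.apply i), hf.continuous.prodMk (continuous_apply i),
    fun M z hz => bddBy_prod.2 ⟨hf.bddBy M z hz, bddBy_self.2 (hz i)⟩⟩

/-- The set of points near which a union of closed bounded sets is not closed has smaller
dimension. -/
lemma IsSigma.interior_image_closure_diff [DiscreteOrInterval L R] [DefinablyBaire L R X]
    {A : Set (ι → R)} (hA : IsSigma L R A) {f : (ι → R) → X} (hf : IsProjection L R f)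
    (hdim : ∀ i, interior ((fun z => (f z, z i)) '' A) = ∅) :
    interior (f '' closure (closure A \ A)) = ∅ := by
  classical
  have := t2Space_of_coordSpace R X
  have : Fintype ι := Fintype.ofFinite ι
  have hAd := hA.defSet
  by_contra hne
  rw [← Ne, ← nonempty_iff_ne_empty] at hne
  set G := closure (closure A \ A) with hG
  have hGd : DefSet L R G := (hAd.closure.diff hAd).closure
  have hGA : G ⊆ closure A := closure_minimal sdiff_subset isClosed_closure
  obtain ⟨r, s₀, hs₀, hrne⟩ := DefinablyBaire.exists_interior_nonempty
    ((SigmaFam.of_closed hGd isClosed_closure).image hf) isOpen_interior hne (by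
      rintro x hx
      obtain ⟨z, hz, rfl⟩ := interior_subset hx
      obtain ⟨M, hM⟩ := exists_bddBy (R := R) z
      obtain ⟨s, hs⟩ := exists_gt (0 : R)
      exact ⟨M, s, hs, z, ⟨hz, hM⟩, rfl⟩)
  set U := interior (slice {p : X × R × R | ∃ z, (z, p.2.1, p.2.2) ∈
    {p : (ι → R) × R × R | p.1 ∈ G ∧ BddBy p.2.1 p.1} ∧ f z = p.1} r s₀) with hUdef
  have hUG : ∀ x ∈ U, ∃ z ∈ G, BddBy r z ∧ f z = x := by
    intro x hx
    obtain ⟨z, ⟨hz, hzr⟩, hzx⟩ := interior_subset hx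
    exact ⟨z, hz, hzr, hzx⟩
  -- The larger bound leaves room for a small box around points of `G` bounded by `r`, so that
  -- points of `closure A` in that box are still in the bounded set `C`.
  obtain ⟨r₁, hr₁⟩ := exists_gt r
  have hCd : DefPred L R fun z : ι → R => z ∈ closure A ∧ BddBy r₁ z := by
    have := hAd.closure
    fun_prop (disch := assumption)
  have hCc : IsClosed {z | z ∈ closure A ∧ BddBy r₁ z} := isClosed_closure.inter (isClosed_bddBy r₁)
  have hCb : IsBdd R {z | z ∈ closure A ∧ BddBy r₁ z} := ⟨r₁, fun z hz => hz.2⟩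
  set C := {z | z ∈ closure A ∧ BddBy r₁ z} with hC
  -- `A` is dense in `closure A`, so if this image had interior, the Σ image of `A` would be dense
  -- there and contain an open set, against `hdim`.
  have hTi : ∀ i, interior ((fun z => (f z, z i)) '' C) = ∅ := by
    intro i
    by_contra hne
    rw [← Ne, ← nonempty_iff_ne_empty] at hne
    obtain ⟨V, -, hVo, hVne, hV⟩ := (hA.image (hf.prodMk_apply i)).exists_open_subset
      isOpen_interior hne (fun V hV hVo ⟨v, hv⟩ => by
        obtain ⟨z, ⟨hz, -⟩, rfl⟩ := interior_subset (hV hv)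
        obtain ⟨z', hz'V, hz'A⟩ := mem_closure_iff.1 hz _
          (hVo.preimage (hf.prodMk_apply i).continuous) hv
        exact ⟨_, hz'V, z', hz'A, rfl⟩)
    have h1 := interior_maximal hV hVo
    rw [hdim i, subset_empty_iff] at h1
    exact hVne.ne_empty h1
  have hsep : ∀ t : Finset ι, ∃ V ⊆ U, IsOpen V ∧ V.Nonempty ∧ ∃ δ : R, 0 < δ ∧
      ∀ x ∈ V, ∀ i ∈ t, Separated δ {y | (x, y) ∈ (fun z => (f z, z i)) '' C} := by
    intro t
    induction t using Finset.induction with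
    | empty =>
      obtain ⟨δ, hδ⟩ := exists_gt (0 : R)
      exact ⟨U, Subset.rfl, isOpen_interior, hrne, δ, hδ, by simp⟩
    | insert j t hj ih =>
      obtain ⟨V, hVU, hVo, hVne, δ, hδ, hV⟩ := ih
      have hp := hf.prodMk_apply j
      obtain ⟨W, hWV, hWo, hWne, δ', hδ', hW⟩ := exists_open_separated_fibres
        (DefSet.image hCd.defSet hp.defMap)
        (isClosed_image hCd.defSet hCc hCb hp.defMap hp.continuous)
        ⟨r₁, by rintro _ ⟨z, hz, rfl⟩; exact hp.bddBy r₁ z hz.2⟩ (hTi j) hVo hVne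
      refine ⟨W, hWV.trans hVU, hWo, hWne, min δ δ', lt_min hδ hδ', fun x hx i hi => ?_⟩
      rcases Finset.mem_insert.1 hi with rfl | hi
      · exact fun y hy z hz hyz => (min_le_right _ _).trans (hW x hx y hy z hz hyz)
      · exact fun y hy z hz hyz => (min_le_left _ _).trans (hV x (hWV hx) i hi y hy z hz hyz)
  obtain ⟨V, hVU, hVo, hVne, δ, hδ, hV⟩ := hsep Finset.univ
  obtain ⟨V', hV'V, hV'o, hV'd, hV'ne⟩ := exists_definable_open_subset (L := L) (R := R) hVo hVne
  obtain ⟨h, hh, hh4⟩ := exists_add_add_add_lt (lt_min hδ (sub_pos.2 hr₁))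
  rw [lt_min_iff] at hh4
  -- The fibre points in `G` are confined one coordinate at a time: shrinking the base pins
  -- coordinate `j` to an interval of length `h`, keeping those already confined.
  have hloc : ∀ t : Finset ι, ∃ W ⊆ V', IsOpen W ∧ DefSet L R W ∧ W.Nonempty ∧ ∃ c : ι → R,
      ∀ x ∈ W, ∃ z ∈ G, BddBy r z ∧ f z = x ∧ ∀ i ∈ t, c i - h ≤ z i ∧ z i ≤ c i := by
    intro t
    induction t using Finset.induction with
    | empty =>
      exact ⟨V', Subset.rfl, hV'o, hV'd, hV'ne, 0, fun x hx => by
        obtain ⟨z, h1, h2, h3⟩ := hUG x (hVU (hV'V hx))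
        exact ⟨z, h1, h2, h3, by simp⟩⟩
    | insert j t hj ih =>
      obtain ⟨W, hWV, hWo, hWd, hWne, c, hW⟩ := ih
      have hp := hf.prodMk_apply j
      have hDd : DefPred L R fun z : ι → R => (z ∈ G ∧ BddBy r z) ∧
          ∀ i : t, c i - h ≤ z i ∧ z i ≤ c i :=
        DefPred.and (by fun_prop (disch := assumption))
          (DefPred.forall_finite fun i => by fun_prop)
      have hDc : IsClosed {z : ι → R | (z ∈ G ∧ BddBy r z) ∧
          ∀ i : t, c i - h ≤ z i ∧ z i ≤ c i} := by
        refine (isClosed_closure.inter (isClosed_bddBy r)).inter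
          (s₂ := {z : ι → R | ∀ i : t, c i - h ≤ z i ∧ z i ≤ c i}) ?_
        have : {z : ι → R | ∀ i : t, c i - h ≤ z i ∧ z i ≤ c i} =
            ⋂ i : t, {z | c i - h ≤ z i ∧ z i ≤ c i} := by ext; simp
        rw [this]
        exact isClosed_iInter fun i => (isClosed_le (by fun_prop) (by fun_prop)).inter
          (isClosed_le (by fun_prop) (by fun_prop))
      obtain ⟨c', W', hW'W, hW'o, hW'd, hW'ne, hW'⟩ := exists_open_fibre_near
        (DefSet.image hDd.defSet hp.defMap)
        (isClosed_image hDd.defSet hDc ⟨r, fun z hz => hz.1.2⟩ hp.defMap hp.continuous) (M := r)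
        (by rintro _ ⟨z, hz, rfl⟩; exact hz.1.2 j) hWo hWd hWne
        (fun x hx => by
          obtain ⟨z, h1, h2, h3, h4⟩ := hW x hx
          exact ⟨z j, z, ⟨⟨h1, h2⟩, fun i => h4 i i.2⟩, by rw [← h3]⟩) hh
      refine ⟨W', hW'W.trans hWV, hW'o, hW'd, hW'ne, Function.update c j c', fun x hx => ?_⟩
      obtain ⟨y, ⟨z, ⟨⟨h1, h2⟩, h3⟩, h4⟩, h5, h6⟩ := hW' x hx
      rw [Prod.ext_iff] at h4
      obtain ⟨h4, rfl⟩ := h4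
      refine ⟨z, h1, h2, h4, fun i hi => ?_⟩
      by_cases hij : i = j
      · subst hij
        rw [Function.update_self]
        exact ⟨h5.le, h6⟩
      · rw [Function.update_of_ne hij]
        exact h3 ⟨i, (Finset.mem_insert.1 hi).resolve_left hij⟩
  obtain ⟨W, hWV, hWo, hWd, ⟨x₀, hx₀⟩, c, hW⟩ := hloc Finset.univ
  have hBo : IsOpen {z : ι → R | ∀ i, c i - h - h < z i ∧ z i < c i + h} := by
    have : {z : ι → R | ∀ i, c i - h - h < z i ∧ z i < c i + h} =
        ⋂ i, {z | c i - h - h < z i ∧ z i < c i + h} := by ext; simp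
    rw [this]
    exact isOpen_iInter_of_finite fun i => (isOpen_lt (by fun_prop) (by fun_prop)).inter
      (isOpen_lt (by fun_prop) (by fun_prop))
  have hBd : DefPred L R fun z : ι → R => ∀ i, c i - h - h < z i ∧ z i < c i + h :=
    DefPred.forall_finite fun i => by fun_prop
  set B := {z : ι → R | ∀ i, c i - h - h < z i ∧ z i < c i + h} with hB
  have hWB : ∀ x ∈ W, ∃ z ∈ G, BddBy r z ∧ f z = x ∧ z ∈ B := by
    intro x hx
    obtain ⟨z, h1, h2, h3, h4⟩ := hW x hx
    refine ⟨z, h1, h2, h3, fun i => ?_⟩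
    have := h4 i (Finset.mem_univ i)
    constructor <;> grind
  have hCB : ∀ z ∈ closure A, z ∈ B → z ∈ C := by
    intro z hz hzB
    obtain ⟨w, -, hw, -, hwB⟩ := hWB x₀ hx₀
    refine ⟨hz, bddBy_pi.2 fun i => ?_⟩
    have h1 := hzB i
    have h2 := hwB i
    have h3 := abs_le.1 (hw i)
    rw [abs_le]
    have h4 := hh4.2
    change _ ≤ w i ∧ w i ≤ _ at h3
    constructor <;> grind
  -- `B` has side `3h < δ`, while over `V` each coordinate of `C` takes `δ`-separated values. So `f`
  -- is injective on the part of `closure A` in `B` lying over `W`.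
  have huniq : ∀ z ∈ closure A, z ∈ B → ∀ w ∈ closure A, w ∈ B → f z = f w → f z ∈ W →
      ∀ i, ¬ z i < w i := by
    intro z hz hzB w hw hwB hzw hzW i hlt
    have := hV _ (hV'V (hWV hzW)) i (Finset.mem_univ i) (z i) ⟨z, hCB z hz hzB, rfl⟩ (w i)
      ⟨w, hCB w hw hwB, by rw [hzw]⟩ hlt
    have h1 := hzB i
    have h2 := hwB i
    have h3 := hh4.1
    grind
  obtain ⟨O, hOW, hOo, ⟨x₁, hx₁⟩, hO⟩ := ((hA.inter (IsSigma.of_open hBd.defSet hBo)).image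
    hf).exists_open_subset hWo ⟨x₀, hx₀⟩ (fun V hVW hVo ⟨x, hx⟩ => by
      obtain ⟨z, hzG, -, rfl, hzB⟩ := hWB x (hVW hx)
      obtain ⟨w, ⟨hwB, hwV⟩, hwA⟩ := mem_closure_iff.1 (hGA hzG) _
        (hBo.inter (hVo.preimage hf.continuous)) ⟨hzB, hx⟩
      exact ⟨f w, hwV, w, ⟨hwA, hwB⟩, rfl⟩)
  obtain ⟨z, hzG, -, rfl, hzB⟩ := hWB x₁ (hOW hx₁)
  -- Over `O` every fibre has a point of `A` in `B`. A point `w` of `closure A \ A` in `B` over `O`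
  -- must coincide with it, which is absurd.
  obtain ⟨w, ⟨hwB, hwO⟩, hwA, hwA'⟩ := mem_closure_iff.1 hzG _
    (hBo.inter (hOo.preimage hf.continuous)) ⟨hzB, hx₁⟩
  obtain ⟨w', ⟨hw'A, hw'B⟩, hw'⟩ := hO hwO
  have : w = w' := funext fun i => le_antisymm
    (not_lt.1 (huniq w' (subset_closure hw'A) hw'B w hwA hwB hw' (hw' ▸ hOW hwO) i))
    (not_lt.1 (huniq w hwA hwB w' (subset_closure hw'A) hw'B hw'.symm (hOW hwO) i))
  exact hwA' (this ▸ hw'A)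

end SigmaSets

/-! ### Dimension by coordinate projections, and constructibility -/

section Dimension

variable {L : Language} {R : Type u} {ι : Type}

variable (R) in
/-- The iterated product of copies of `R` indexed by the entries of a list. -/
def ListPower : List ι → Type u
  | [] => PUnit
  | _ :: l => ListPower l × R

instance [TopologicalSpace R] : ∀ l : List ι, TopologicalSpace (ListPower R l)
  | [] => inferInstanceAs (TopologicalSpace PUnit)
  | _ :: l =>
    have := instTopologicalSpaceListPower l
    inferInstanceAs (TopologicalSpace (ListPower R l × R))

instance [TopologicalSpace R] : ∀ l : List ι, CoordSpace R (ListPower R l)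
  | [] => inferInstanceAs (CoordSpace R PUnit)
  | _ :: l =>
    have := instCoordSpaceListPower l
    inferInstanceAs (CoordSpace R (ListPower R l × R))

/-- The projection to the coordinates in a list. -/
def listProj : (l : List ι) → (ι → R) → ListPower R l
  | [], _ => PUnit.unit
  | i :: l, z => (listProj l z, z i)

variable [TopologicalSpace R] [L.Structure R] [AddCommGroup R]
  [LinearOrder R] [IsOrderedAddMonoid R] [DefinablyCompleteGroup L R]
  [DenselyOrdered R] [Nontrivial R] [OrderTopology R]
variable {X : Type*} [TopologicalSpace X] [CoordSpace R X]

/-- Indexing projections by lists makes adding a coordinate literally a product with `R`, so the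
Baire property propagates by recursion from the one-point space. -/
instance definablyBaire_listPower [DiscreteOrInterval L R] : ∀ l : List ι, DefinablyBaire L R (ListPower R l)
  | [] => inferInstanceAs (DefinablyBaire L R PUnit)
  | _ :: l =>
    have := definablyBaire_listPower l
    inferInstanceAs (DefinablyBaire L R (ListPower R l × R))

lemma isProjection_listProj [Finite ι] (l : List ι) :
    IsProjection L R (listProj l : (ι → R) → ListPower R l) := by
  induction l with
  | nil => exact ⟨DefMap.const PUnit.unit, continuous_const, fun M z hz i => i.elim⟩
  | cons i l ih => exact ih.prodMk_apply i

lemma interior_graph (g : X → R) : interior {p : X × R | p.2 = g p.1} = ∅ := by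
  refine eq_empty_of_forall_notMem fun p hp => ?_
  obtain ⟨ε, hε, h⟩ := (mem_interior_iff_near (R := R)).1 hp
  obtain ⟨δ, hδ, hδε⟩ := exists_between hε
  have h1 : p ∈ {p : X × R | p.2 = g p.1} := interior_subset hp
  change p.2 = g p.1 at h1
  have h2 : p.2 + δ = g p.1 := h (p.1, p.2 + δ)
    (near_prod.2 ⟨near_refl hε _, by simpa [abs_of_pos hδ] using hδε⟩)
  rw [← h1] at h2
  exact hδ.ne' (by simpa using h2)

lemma exists_continuous_listProj_apply {l : List ι} {i : ι} (hi : i ∈ l) :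
    ∃ g : ListPower R l → R, ∀ z, g (listProj l z) = z i := by
  induction l with
  | nil => simp at hi
  | cons j l ih =>
    rcases List.mem_cons.1 hi with rfl | h
    · exact ⟨Prod.snd, fun z => rfl⟩
    · obtain ⟨g, hg⟩ := ih h
      exact ⟨fun p => g p.1, fun z => hg z⟩

/-- A repeated index puts the image inside a graph, which has no interior; shorter projections
inherit interior because projections are open. This bounds the dimension by the number of
coordinates. -/
lemma nodup_of_interior_listProj_nonempty {l : List ι} (A : Set (ι → R))
    (h : (interior (listProj l '' A)).Nonempty) : l.Nodup := by
  induction l with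
  | nil => exact List.nodup_nil
  | cons i l ih =>
    refine List.nodup_cons.2 ⟨fun hi => ?_, ih ?_⟩
    · obtain ⟨g, hg⟩ := exists_continuous_listProj_apply (R := R) hi
      have hsub : listProj (i :: l) '' A ⊆ {p : ListPower R l × R | p.2 = g p.1} := by
        rintro _ ⟨z, -, rfl⟩
        exact (hg z).symm
      obtain ⟨p, hp⟩ := h
      have h2 := interior_mono hsub hp
      have h3 := interior_graph (R := R) g
      exact (h3 ▸ h2 : p ∈ (∅ : Set (ListPower R l × R)))
    · obtain ⟨p, hp⟩ := h
      have h1 : IsOpen (Prod.fst '' (interior (listProj (i :: l) '' A) :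
          Set (ListPower R l × R))) := isOpenMap_fst _ isOpen_interior
      refine ⟨p.1, interior_maximal ?_ h1 ⟨p, hp, rfl⟩⟩
      rintro _ ⟨q, hq, rfl⟩
      obtain ⟨z, hz, hzq⟩ := interior_subset hq
      exact ⟨z, hz, by rw [← hzq]; rfl⟩

variable (L R) in
/-- Finite Boolean combinations of definable open sets. -/
def DefConstructible (S : Set X) : Prop :=
  S ∈ BooleanSubalgebra.closure {U : Set X | IsOpen U ∧ DefSet L R U}

lemma DefConstructible.of_open {U : Set X} (hU : IsOpen U) (hUd : DefSet L R U) :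
    DefConstructible L R U := BooleanSubalgebra.subset_closure ⟨hU, hUd⟩

lemma DefConstructible.of_closed {C : Set X} (hC : IsClosed C) (hCd : DefSet L R C) :
    DefConstructible L R C := by
  have := BooleanSubalgebra.compl_mem (DefConstructible.of_open hC.isOpen_compl hCd.compl)
  rwa [compl_compl] at this

lemma DefConstructible.isSigma {S : Set X} (h : DefConstructible L R S) :
    IsSigma L R S ∧ IsSigma L R Sᶜ := by
  induction h using BooleanSubalgebra.closure_bot_sup_induction with
  | mem U hU =>
    exact ⟨.of_open hU.2 hU.1, .of_closed hU.2.compl hU.1.isClosed_compl⟩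
  | bot =>
    exact ⟨.of_closed (DefPred.const False) isClosed_empty,
      .of_closed (DefPred.const False).not (by simp)⟩
  | sup S hS T hT ihS ihT =>
    refine ⟨ihS.1.union ihT.1, ?_⟩
    rw [compl_sup]
    exact ihS.2.inter ihT.2
  | compl S hS ih => exact ⟨ih.2, by rw [compl_compl]; exact ih.1⟩

/-- Induction on `d`, where the hypothesis says that the dimension is less than `d`. The projection
to the empty list is onto a point for nonempty `A`, so `d = 0` forces `A` empty. -/
lemma IsSigma.defConstructible_of_interior_listProj [Finite ι] [DiscreteOrInterval L R] (d : ℕ)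
    {A : Set (ι → R)} (hA : IsSigma L R A)
    (h : ∀ l : List ι, l.length = d → interior (listProj l '' A) = ∅) :
    DefConstructible L R A := by
  induction d generalizing A with
  | zero =>
    have : A = ∅ := by
      by_contra hne
      obtain ⟨z, hz⟩ := nonempty_iff_ne_empty.2 hne
      have h1 : listProj [] '' A = univ := eq_univ_of_forall fun x => ⟨z, hz, rfl⟩
      have h2 := h [] rfl
      rw [h1, interior_univ] at h2
      exact (h2 ▸ mem_univ PUnit.unit : PUnit.unit ∈ (∅ : Set (ListPower R ([] : List ι))))
    rw [this]
    exact BooleanSubalgebra.bot_mem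
  | succ d ih =>
    have hAd := hA.defSet
    have hGd := (hAd.closure.diff hAd).closure
    have hG : DefConstructible L R (closure (closure A \ A)) := .of_closed isClosed_closure hGd
    have h1 : DefConstructible L R (A ∩ closure (closure A \ A)) := by
      refine ih (hA.inter (.of_closed hGd isClosed_closure)) fun l hl => ?_
      -- Prepending any `i` to `l` gives a list of length `d + 1`, so `h` supplies the hypothesis of
      -- the dimension drop.
      have := hA.interior_image_closure_diff (isProjection_listProj l)
        fun i => h (i :: l) (by simp [hl])
      exact subset_empty_iff.1 (this ▸ interior_mono (image_mono inter_subset_right))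
    have h2 := BooleanSubalgebra.sup_mem (BooleanSubalgebra.sdiff_mem
      (DefConstructible.of_closed isClosed_closure hAd.closure) hG) h1
    refine (congrArg _ ?_ : DefConstructible L R A = _).mpr h2
    ext z
    change z ∈ A ↔ (z ∈ closure A ∧ z ∉ _) ∨ (z ∈ A ∧ z ∈ _)
    constructor
    · intro hz
      by_cases hzG : z ∈ closure (closure A \ A)
      · exact Or.inr ⟨hz, hzG⟩
      · exact Or.inl ⟨subset_closure hz, hzG⟩
    · rintro (⟨h1, h2⟩ | ⟨h1, -⟩)
      · by_contra hz
        exact h2 (subset_closure ⟨h1, hz⟩)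
      · exact h1

lemma IsSigma.defConstructible [Finite ι] [DiscreteOrInterval L R] {A : Set (ι → R)}
    (hA : IsSigma L R A) : DefConstructible L R A := by
  have : Fintype ι := Fintype.ofFinite ι
  refine hA.defConstructible_of_interior_listProj (Fintype.card ι + 1) fun l hl => ?_
  by_contra hne
  have := (nodup_of_interior_listProj_nonempty A (nonempty_iff_ne_empty.2 hne)).length_le_card
  omega

lemma IsSigma.compl [Finite ι] [DiscreteOrInterval L R] {A : Set (ι → R)}
    (hA : IsSigma L R A) : IsSigma L R Aᶜ := hA.defConstructible.isSigma.2

end Dimension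

/-! ### Sets definable in the open core, and local o-minimality -/

section OpenCore

open FirstOrder.Language

variable {L : Language} {R : Type u} [TopologicalSpace R] [L.Structure R] [AddCommGroup R]
  [LinearOrder R] [IsOrderedAddMonoid R] [DefinablyCompleteGroup L R]
  [DenselyOrdered R] [Nontrivial R] [OrderTopology R]

lemma openCore_term_realize {α : Type} (t : (openCoreLanguage L R)[[(univ : Set R)]].Term α) :
    (∃ a, ∀ v : α → R, t.realize v = v a) ∨ ∃ c, ∀ v : α → R, t.realize v = c := by
  cases t with
  | var a => exact Or.inl ⟨a, fun v => rfl⟩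
  | @func n f ts =>
    rcases f with f | f
    · exact f.elim
    · cases n with
      | zero =>
        refine Or.inr ⟨Term.realize (fun _ => (0 : R)) (Term.func (Sum.inr f) ts), fun v => ?_⟩
        exact congrArg (Structure.funMap (L := (openCoreLanguage L R)[[(univ : Set R)]]) (M := R)
          (Sum.inr f)) (funext fun i => i.elim0)
      | succ n => exact (isEmpty_functions_constantsOn_succ.false f).elim

/-- Induction on formulas. Terms are variables or constants, hence continuous, so atomic formulas
define closed or open sets. Implication needs stability under complement, and `∀` is treated as
`¬∃¬` with projection for `∃`. -/
lemma isSigma_openCore_realize [DiscreteOrInterval L R] {α : Type} [Finite α] {n : ℕ}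
    (φ : (openCoreLanguage L R)[[(univ : Set R)]].BoundedFormula α n) :
    IsSigma L R {w : α ⊕ Fin n → R | φ.Realize (w ∘ Sum.inl) (w ∘ Sum.inr)} := by
  have hterm : ∀ {β : Type} [Finite β] (t : (openCoreLanguage L R)[[(univ : Set R)]].Term β),
      DefMap L R (fun w : β → R => t.realize w) ∧ Continuous fun w : β → R => t.realize w := by
    intro β _ t
    rcases openCore_term_realize t with ⟨a, ha⟩ | ⟨c, hc⟩
    · simp only [ha]
      exact ⟨DefMap.apply a, continuous_apply a⟩
    · simp only [hc]
      exact ⟨DefMap.const c, continuous_const⟩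
  induction φ with
  | falsum => exact .of_closed (DefPred.const False) isClosed_empty
  | equal t₁ t₂ =>
    simp only [BoundedFormula.Realize, Sum.elim_comp_inl_inr]
    exact .of_closed ((hterm t₁).1.eq (hterm t₂).1) (isClosed_eq (hterm t₁).2 (hterm t₂).2)
  | @rel n k r ts =>
    simp only [BoundedFormula.Realize, Sum.elim_comp_inl_inr]
    rcases r with U | r
    · have h1 : DefMap L R fun w : α ⊕ Fin n → R => fun i => (ts i).realize w :=
        DefMap.pi fun i => (hterm (ts i)).1
      have h2 : DefSet L R (U.1 : Set (Fin k → R)) := U.2.1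
      exact .of_open (h1.mem h2) (U.2.2.preimage (continuous_pi fun i => (hterm (ts i)).2))
    · exact r.elim
  | imp φ ψ ih₁ ih₂ =>
    convert ih₁.compl.union ih₂ using 1
    ext w
    simp [imp_iff_not_or]
  | @all n φ ih =>
    have hp : IsProjection L R fun z : α ⊕ Fin (n + 1) → R =>
        (fun i => z (Sum.map id Fin.castSucc i) : α ⊕ Fin n → R) :=
      ⟨DefMap.pi fun i => DefMap.apply _, continuous_pi fun i => continuous_apply _,
        fun M z hz i => hz _⟩
    convert (ih.compl.image hp).compl using 1
    ext w
    simp only [BoundedFormula.realize_all, mem_ofPred_eq, mem_compl_iff, mem_image, not_exists,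
      not_and]
    constructor
    · rintro h z hz rfl
      refine hz ?_
      have h1 := h (z (Sum.inr (Fin.last n)))
      have h2 : (Fin.snoc ((fun i => z (Sum.map id Fin.castSucc i) : α ⊕ Fin n → R) ∘ Sum.inr)
          (z (Sum.inr (Fin.last n))) : Fin (n + 1) → R) = z ∘ Sum.inr :=
        funext fun i => Fin.lastCases (by simp) (fun i => by simp) i
      rw [h2] at h1
      exact h1
    · intro h a
      by_contra hcon
      refine h (Sum.elim (w ∘ Sum.inl) (Fin.snoc (w ∘ Sum.inr) a)) (by simpa using hcon) ?_
      funext i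
      rcases i with i | i <;> simp

lemma isSigma_of_openCore_definable [DiscreteOrInterval L R] {α : Type} [Finite α]
    {S : Set (α → R)} (hS : (univ : Set R).Definable (openCoreLanguage L R) S) :
    IsSigma L R S := by
  obtain ⟨φ, rfl⟩ := hS
  have hp : IsProjection L R fun z : α ⊕ Fin 0 → R => (fun i => z (Sum.inl i) : α → R) :=
    ⟨DefMap.pi fun i => DefMap.apply _, continuous_pi fun i => continuous_apply _,
      fun M z hz i => hz _⟩
  convert (isSigma_openCore_realize φ).image hp using 1
  ext v
  constructor
  · intro hv
    exact ⟨Sum.elim v default, hv, rfl⟩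
  · rintro ⟨z, hz, rfl⟩
    change BoundedFormula.Realize φ (z ∘ Sum.inl) (z ∘ Sum.inr) at hz
    rw [Subsingleton.elim (z ∘ Sum.inr) default] at hz
    exact hz

/-- `S` is dense in any open part of its frontier; being Σ, it would contain an open subset, whose
points are interior to `S` and so not on the frontier. -/
lemma interior_frontier_of_openCore_definable [DiscreteOrInterval L R] {S : Set R}
    (hS : (univ : Set R).Definable₁ (openCoreLanguage L R) S) :
    DefSet L R S ∧ interior (frontier S) = ∅ := by
  have hp : IsProjection L R fun z : Fin 1 → R => z 0 :=
    ⟨DefMap.apply 0, continuous_apply 0, fun M z hz => bddBy_self.2 (hz (show Fin 1 from 0))⟩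
  have h1 := isSigma_of_openCore_definable (α := Fin 1) hS
  have e : ∀ T : Set R, (fun z : Fin 1 → R => z 0) '' {x | x 0 ∈ T} = T := by
    intro T
    ext x
    exact ⟨fun ⟨z, hz, hzx⟩ => hzx ▸ hz, fun hx => ⟨fun _ => x, hx, rfl⟩⟩
  have h2 := h1.image hp
  rw [e] at h2
  refine ⟨h2.defSet, ?_⟩
  by_contra hne
  obtain ⟨V, hVU, hVo, ⟨x, hx⟩, hV⟩ := h2.exists_open_subset isOpen_interior
    (nonempty_iff_ne_empty.2 hne) fun V hV hVo ⟨x, hx⟩ =>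
      mem_closure_iff.1 (frontier_subset_closure (interior_subset (hV hx))) V hVo hx
  have h3 : x ∈ frontier S := interior_subset (hVU hx)
  rw [frontier, mem_sdiff] at h3
  exact h3.2 (interior_maximal hV hVo hx)

/-- Definable subsets of the line have a boundary point between a point inside and a point
outside. -/
lemma DefSet.exists_mem_frontier {S : Set R} (hS : DefSet L R S) {x y : R} (hx : x ∈ S)
    (hy : y ∉ S) (hxy : x < y) : ∃ z ∈ Icc x y, z ∈ frontier S := by
  have hd : DefPred L R fun z : R => z ≤ y ∧ z ∈ S := by fun_prop (disch := assumption)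
  obtain ⟨c, hc⟩ := hd.defSet.exists_isLUB ⟨x, hxy.le, hx⟩ ⟨y, fun z hz => hz.1⟩
  have hxc : x ≤ c := hc.1 ⟨hxy.le, hx⟩
  have hcy : c ≤ y := hc.2 fun z hz => hz.1
  refine ⟨c, ⟨hxc, hcy⟩, closure_mono (fun z hz => hz.2) (hc.mem_closure ⟨x, hxy.le, hx⟩), ?_⟩
  intro hi
  rcases hcy.lt_or_eq with h | rfl
  · obtain ⟨l, u, ⟨hl, hu⟩, hlu⟩ := mem_nhds_iff_exists_Ioo_subset.1
      (isOpen_interior.mem_nhds hi)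
    obtain ⟨w, hw1, hw2⟩ := exists_between (lt_min hu h)
    rw [lt_min_iff] at hw2
    exact absurd (hc.1 ⟨hw2.2.le, interior_subset (hlu ⟨hl.trans hw1, hw2.1⟩)⟩) (not_le.2 hw1)
  · exact hy (interior_subset hi)

lemma DefSet.subset_or_disjoint_of_frontier {S : Set R} (hS : DefSet L R S) {a b : R}
    (h : ∀ z ∈ Ioo a b, z ∉ frontier S) : Ioo a b ⊆ S ∨ Ioo a b ⊆ Sᶜ := by
  by_contra! hcon
  obtain ⟨⟨x, hx, hxS⟩, ⟨y, hy, hyS⟩⟩ :=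
    (⟨not_subset.1 hcon.1, not_subset.1 hcon.2⟩ : (∃ x ∈ Ioo a b, x ∉ S) ∧ ∃ y ∈ Ioo a b, y ∉ Sᶜ)
  rw [notMem_compl_iff] at hyS
  rcases lt_trichotomy x y with hxy | rfl | hxy
  · obtain ⟨z, hz, hzf⟩ := hS.compl.exists_mem_frontier hxS (not_not.2 hyS) hxy
    rw [frontier_compl] at hzf
    exact h z ⟨hx.1.trans_le hz.1, hz.2.trans_lt hy.2⟩ hzf
  · exact hxS hyS
  · obtain ⟨z, hz, hzf⟩ := hS.exists_mem_frontier hyS hxS hxy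
    exact h z ⟨hy.1.trans_le hz.1, hz.2.trans_lt hx.2⟩ hzf

/-- The frontier is closed and discrete, so some `(c, d)` around `a` meets it at most in `a`. By
definable connectedness `(c, a)` and `(a, d)` each lie inside `S` or outside it. -/
theorem locallyOMinimal_openCore [DiscreteOrInterval L R] :
    LocallyOMinimal (openCoreLanguage L R) R := by
  classical
  intro S hS a
  obtain ⟨hSd, hSf⟩ := interior_frontier_of_openCore_definable hS
  have hFd : DefSet L R (frontier S) := hSd.closure.diff hSd.interior
  have hdisc : DiscreteTopology (frontier S) := by
    rcases DiscreteOrInterval.out _ hFd.definable₁ isClosed_frontier with h | ⟨p, q, hpq, h⟩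
    · exact h
    · exact absurd h (interior_eq_empty_iff_Ioo.1 hSf p q (nonempty_Ioo.1 hpq))
  have hc : IsClosed (frontier S \ {a}) := by
    have h1 : IsClosed ((↑) ⁻¹' (frontier S \ {a}) : Set (frontier S)) := isClosed_discrete _
    have h2 := isClosed_frontier.isClosedEmbedding_subtypeVal.isClosedMap _ h1
    rwa [Subtype.image_preimage_coe, inter_eq_self_of_subset_right sdiff_subset] at h2
  obtain ⟨c, d, ⟨hca, had⟩, hcd⟩ := mem_nhds_iff_exists_Ioo_subset.1
    (hc.isOpen_compl.mem_nhds (show a ∉ frontier S \ {a} from fun h => h.2 rfl))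
  have hleft := hSd.subset_or_disjoint_of_frontier (a := c) (b := a) fun z hz hzf =>
    hcd ⟨hz.1, hz.2.trans had⟩ ⟨hzf, hz.2.ne⟩
  have hright := hSd.subset_or_disjoint_of_frontier (a := a) (b := d) fun z hz hzf =>
    hcd ⟨hca.trans hz.1, hz.2⟩ ⟨hzf, hz.1.ne'⟩
  refine ⟨c, d, ⟨hca, had⟩, S ∩ {a}, (if Ioo c a ⊆ S then {(c, a)} else ∅) ∪
    (if Ioo a d ⊆ S then {(a, d)} else ∅), (finite_singleton a).subset inter_subset_right,
    Finite.union (by split_ifs <;> simp) (by split_ifs <;> simp), ?_⟩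
  ext z
  simp only [mem_inter_iff, mem_union, mem_iUnion, mem_singleton_iff, exists_prop]
  constructor
  · rintro ⟨hz, hzc, hzd⟩
    rcases lt_trichotomy z a with h | h | h
    · have hl : Ioo c a ⊆ S := hleft.resolve_right fun h' => h' ⟨hzc, h⟩ hz
      exact Or.inr ⟨(c, a), Or.inl (by simp [hl]), hzc, h⟩
    · exact Or.inl ⟨hz, h⟩
    · have hr : Ioo a d ⊆ S := hright.resolve_right fun h' => h' ⟨h, hzd⟩ hz
      exact Or.inr ⟨(a, d), Or.inr (by simp [hr]), h, hzd⟩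
  · rintro (⟨hz, rfl⟩ | ⟨p, hp | hp, hzp⟩)
    · exact ⟨hz, hca, had⟩
    · split_ifs at hp with h
      · rw [mem_singleton_iff.1 hp] at hzp
        exact ⟨h hzp, hzp.1, hzp.2.trans had⟩
      · exact hp.elim
    · split_ifs at hp with h
      · rw [mem_singleton_iff.1 hp] at hzp
        exact ⟨h hzp, hca.trans hzp.1, hzp.2⟩
      · exact hp.elim

lemma definable_openCore_of_isClosed {S : Set R} (hS : (univ : Set R).Definable₁ L S)
    (hc : IsClosed S) : (univ : Set R).Definable₁ (openCoreLanguage L R) S := by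
  let U : (openCoreLanguage L R).Relations 1 :=
    ⟨{x : Fin 1 → R | x 0 ∈ S}ᶜ, Set.Definable.compl hS,
      (hc.preimage (continuous_apply 0)).isOpen_compl⟩
  have h : (univ : Set R).Definable (openCoreLanguage L R) {x : Fin 1 → R | x 0 ∈ S}ᶜ := by
    refine Set.Definable.mono (A := ∅) ?_ (empty_subset _)
    rw [empty_definable_iff]
    refine ⟨Relations.formula U fun i => Term.var i, ?_⟩
    ext v
    change _ ↔ Formula.Realize _ v
    rw [Formula.realize_rel]
    rfl
  have := h.compl
  rwa [compl_compl] at this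

theorem discreteOrInterval_of_locallyOMinimal
    (h : LocallyOMinimal (openCoreLanguage L R) R) :
    DefinableClosedSetsDiscreteOrContainInterval L R := by
  intro S hS hc
  by_cases hI : ∃ a b : R, (Ioo a b).Nonempty ∧ Ioo a b ⊆ S
  · exact Or.inr hI
  left
  push Not at hI
  rw [discreteTopology_subtype_iff]
  intro a ha
  obtain ⟨c, d, hacd, P, J, hP, hJ, heq⟩ := h S (definable_openCore_of_isClosed hS hc) a
  -- Since `S` contains no interval, the intervals in the local decomposition are all empty and only
  -- the finite set of points remains.
  have hfin : S ∩ Ioo c d ⊆ P := by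
    rw [heq]
    refine union_subset Subset.rfl (iUnion₂_subset fun p hp => ?_)
    by_cases hne : (Ioo p.1 p.2).Nonempty
    · refine absurd ?_ (hI p.1 p.2 hne)
      intro z hz
      have : z ∈ S ∩ Ioo c d := heq ▸ Or.inr (mem_iUnion₂.2 ⟨p, hp, hz⟩)
      exact this.1
    · rw [not_nonempty_iff_eq_empty.1 hne]
      exact empty_subset _
  have hfinite := hP.subset hfin
  rw [← disjoint_iff, Filter.disjoint_iff]
  refine ⟨{a}ᶜ ∩ ((S ∩ Ioo c d) \ {a})ᶜ ∩ Ioo c d, ?_, S, Filter.mem_principal_self S, ?_⟩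
  · refine Filter.inter_mem (Filter.inter_mem self_mem_nhdsWithin ?_) ?_
    · exact mem_nhdsWithin_of_mem_nhds ((hfinite.subset sdiff_subset).isClosed.isOpen_compl.mem_nhds
        fun h => h.2 rfl)
    · exact mem_nhdsWithin_of_mem_nhds (isOpen_Ioo.mem_nhds hacd)
  · rw [disjoint_left]
    rintro z ⟨⟨hza, hz⟩, hzcd⟩ hzS
    exact hz ⟨⟨hzS, hzcd⟩, hza⟩

end OpenCore

/-! ### Transfer from the ordered group language, and the theorem -/

lemma DefinablyComplete.definablyCompleteGroup {R : Type u} [AddCommGroup R] [LinearOrder R]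
    (L : Language) [L.Structure R] (φ : orderedGroupLanguage →ᴸ L) [φ.IsExpansionOn R]
    (hR : DefinablyComplete L R) : DefinablyCompleteGroup L R where
  definable_lt := by
    refine Set.Definable.mono (A := ∅) (Set.Definable.map_expansion (L := orderedGroupLanguage)
      ?_ φ) (empty_subset _)
    rw [empty_definable_iff]
    let r : orderedGroupLanguage.Relations 2 := OrderedGroupRelations.lt
    refine ⟨r.formula fun i => Language.Term.var i, ?_⟩
    ext v
    change _ ↔ Language.Formula.Realize _ v
    rw [Language.Formula.realize_rel]
    rfl
  definable_add := by
    refine Set.Definable.mono (A := ∅) (Set.Definable.map_expansion (L := orderedGroupLanguage)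
      ?_ φ) (empty_subset _)
    rw [empty_definable_iff]
    refine ⟨Language.Term.equal (Language.Term.func (L := orderedGroupLanguage)
      OrderedGroupFunctions.add ![Language.Term.var 0, Language.Term.var 1])
      (Language.Term.var 2), ?_⟩
    ext v
    change _ ↔ Language.Formula.Realize _ v
    rw [Language.Formula.realize_equal]
    rfl
  complete := hR

theorem theorem1p1 {R : Type*} [AddCommGroup R] [LinearOrder R] [IsOrderedAddMonoid R]
    [DenselyOrdered R] [Nontrivial R] [TopologicalSpace R] [OrderTopology R]
    (L : Language) [L.Structure R] (φ : orderedGroupLanguage →ᴸ L) [φ.IsExpansionOn R]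
    (hR : DefinablyComplete L R) :
    (DefinableClosedSetsDiscreteOrContainInterval L R ↔
      LocallyOMinimal (openCoreLanguage L R) R) ∧
    (DefinableClosedSetsDiscreteOrContainInterval L R ∨
        LocallyOMinimal (openCoreLanguage L R) R →
      ∀ (n : ℕ) (S : Set (Fin n → R)), (univ : Set R).Definable (openCoreLanguage L R) S →
        IsFiniteBooleanCombinationOfOpens S) := by
  have := hR.definablyCompleteGroup L φ
  refine ⟨⟨fun h => ?_, discreteOrInterval_of_locallyOMinimal⟩, fun h n S hS => ?_⟩
  · have : DiscreteOrInterval L R := ⟨h⟩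
    exact locallyOMinimal_openCore
  · have : DiscreteOrInterval L R := ⟨h.elim id discreteOrInterval_of_locallyOMinimal⟩
    exact BooleanSubalgebra.closure_mono (fun U hU => hU.1)
      (isSigma_of_openCore_definable hS).defConstructible
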